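/- Let $k$ be a field, $n,l,N\ge 0$ integers, and $f=(f_1,\dots,f_l):\mathbb A^{n+l}\to\mathbb A^l$ a morphism over $k$, given by polynomials $f_i\in k[x_1,\dots,x_n,y_1,\dots,y_l]$. Put $Q:=\det(\partial f/\partial y)$, $X:=f^{-1}(0)\subset\mathbb A^{n+l}$, and let $\Delta_X\subset X$ be the closed subscheme of zeros of $Q$. For a $k$-algebra $R$, "monic of degree $N$" means of the form $t^N+c_1t^{N-1}+\dots+c_N\in R[t]$. (i) There is a $k$-scheme $Z$ representing the functor that associates to a $k$-algebra $R$ the set of pairs consisting of a monic polynomial $q\in R[t]$ of degree $N$ and an element of $\varprojlim_r X(R[t]/(q^r))$ such that the scheme-theoretic preimage of $\Delta_X$ in $\operatorname{Spec}R[t]/(q^2)$ equals $\operatorname{Spec}R[t]/(q)$. (ii) $Z$ is isomorphic over $k$ to the product of a $k$-scheme of finite type and an affine space, with coordinates indexed by $\{1,\dots,n\}\times\{1,\dots,N\}\times\mathbb N$ (so it is infinite-dimensional if $nN>0$). (iii) For $r\ge 2$ consider the functor that associates to a $k$-algebra $R$ the set of triples $(q,\bar x,\bar y)$, where $q\in R[t]$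 is monic of degree $N$, $\bar x\in(R[t]/(q^r))^n$ and $\bar y\in(R[t]/(q^{r-1}))^l$, such that * $f(\bar x,\bar y)\equiv 0 \bmod q^{r-1}$ and $Q(\bar x,\bar y)\equiv 0\bmod q$; * $\hat C f(\bar x,\bar y)\equiv 0\bmod q^r$, where $\hat C$ is the adjugate of $C:=\frac{\partial f}{\partial y}(\bar x,\bar y)$ (this is computed with a lift of $\bar y$ to $(R[t]/(q^r))^l$, and the choice of the lift does not matter); * if $r\ge 3$, then the element $q^{-1}Q(\bar x,\bar y)\in R[t]/(q^{r-2})$ is invertible. This functor is representable by an affine $k$-scheme $Z_r$ of finite type. With respect to the truncation morphisms $Z\to Z_r$ and $Z_{r+1}\to Z_r$ (reduce $x$ modulo $q^r$ and $y$ modulo $q^{r-1}$), $Z$ is the limit of the $Z_r$, $r\ge 2$, in the category of $k$-schemes. For every $r\ge 2$ the morphism $Z_{r+1}\to Z_r$ is smooth of relative dimension $nN$, and each of its nonempty fibers has dimension $nN$. For $r\ge 3$, the scheme $Z_{r+1}$ is isomorphic, as a scheme over $Z_r$, to $Z_r\times\mathbb A^{nN}$. -/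

import Mathlib

open CategoryTheory Limits AlgebraicGeometry
open scoped Polynomial

universe u

namespace NewtonArc

section Truncation

variable {k R S T : Type u} [Field k] [CommRing R] [Algebra k R] [CommRing S] [Algebra k S]
  [CommRing T] [Algebra k T]

/-- The `k`-algebra `R[t]/(q ^ r)`. -/
abbrev Trunc (q : R[X]) (r : ℕ) : Type u := R[X] ⧸ Ideal.span {q ^ r}

/-- The class of a polynomial `g ∈ R[t]` in `R[t]/(q ^ r)`. -/
noncomputable def cls (q : R[X]) (r : ℕ) : R[X] →+* Trunc q r := Ideal.Quotient.mk _

theorem cls_surjective (q : R[X]) (r : ℕ) : Function.Surjective (cls q r) :=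
  Ideal.Quotient.mk_surjective

variable (k) in
/-- The reduction map `R[t]/(q ^ r) → R[t]/(q ^ s)` for `s ≤ r`. -/
noncomputable def red (q : R[X]) {r s : ℕ} (h : s ≤ r) : Trunc q r →ₐ[k] Trunc q s :=
  Ideal.Quotient.factorₐ k ((Ideal.span_singleton_le_span_singleton).2 (pow_dvd_pow q h))

@[simp] theorem red_cls (q : R[X]) {r s : ℕ} (h : s ≤ r) (g : R[X]) :
    red k q h (cls q r g) = cls q s g := rfl

theorem red_red (q : R[X]) {r s v : ℕ} (h : s ≤ r) (h' : v ≤ s) (a : Trunc q r) :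
    red k q h' (red k q h a) = red k q (h'.trans h) a := by
  obtain ⟨g, rfl⟩ := cls_surjective q r a
  rfl

/-- The map `R[t]/(q ^ r) → S[t]/(q ^ r)` induced by a homomorphism `φ : R → S`, the polynomial
`q` on the right being the image of `q` under `φ`. -/
noncomputable def baseChange (φ : R →ₐ[k] S) (q : R[X]) (r : ℕ) :
    Trunc q r →ₐ[k] Trunc (q.map (φ : R →+* S)) r :=
  Ideal.quotientMapₐ _ (Polynomial.mapAlgHom φ) (by
    rw [Ideal.span_singleton_le_iff_mem, Ideal.mem_comap]
    refine Ideal.mem_span_singleton.2 ?_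
    simp)

@[simp] theorem baseChange_cls (φ : R →ₐ[k] S) (q : R[X]) (r : ℕ) (g : R[X]) :
    baseChange φ q r (cls q r g) = cls _ r (g.map (φ : R →+* S)) := rfl

theorem red_baseChange (φ : R →ₐ[k] S) (q : R[X]) {r s : ℕ} (h : s ≤ r) (a : Trunc q r) :
    red k _ h (baseChange φ q r a) = baseChange φ q s (red k q h a) := by
  obtain ⟨g, rfl⟩ := cls_surjective q r a
  rfl

/-- `q` is monic of degree `N`, in the sense `q = t ^ N + c₁ t ^ (N - 1) + ⋯ + c_N`. (If `R ≠ 0`,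
this says that `q` is monic and `q.natDegree = N`. Over the zero ring there is exactly one such
`q` for every `N`.) -/
def IsMonicDeg (N : ℕ) (q : R[X]) : Prop := q.natDegree ≤ N ∧ q.coeff N = 1

theorem IsMonicDeg.map {N : ℕ} {q : R[X]} (h : IsMonicDeg N q) (φ : R →ₐ[k] S) :
    IsMonicDeg N (q.map (φ : R →+* S)) :=
  ⟨Polynomial.natDegree_map_le.trans h.1, by simp [h.2]⟩

end Truncation

section Equations

variable {k : Type u} [Field k] {n l : ℕ} {A B : Type u} [CommRing A] [Algebra k A]
  [CommRing B] [Algebra k B]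

/-- The matrix `∂f/∂y` of partial derivatives of the `f i` with respect to the `y`-variables
`Sum.inr j`; the `x`-variables are the `Sum.inl i`. -/
noncomputable def jacobian (f : Fin l → MvPolynomial (Fin n ⊕ Fin l) k) :
    Matrix (Fin l) (Fin l) (MvPolynomial (Fin n ⊕ Fin l) k) :=
  Matrix.of fun i j => MvPolynomial.pderiv (Sum.inr j) (f i)

/-- `Q = det (∂f/∂y)`. -/
noncomputable def jacDet (f : Fin l → MvPolynomial (Fin n ⊕ Fin l) k) :
    MvPolynomial (Fin n ⊕ Fin l) k :=
  (jacobian f).det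

/-- The set `X(A)` of `A`-points of `X = f⁻¹(0) ⊆ 𝔸^(n+l)`. -/
def solutions (f : Fin l → MvPolynomial (Fin n ⊕ Fin l) k) (A : Type u) [CommRing A]
    [Algebra k A] : Set (Fin n ⊕ Fin l → A) :=
  {z | ∀ i, MvPolynomial.aeval z (f i) = 0}

/-- The vector `f(z)`. -/
noncomputable def valAt (f : Fin l → MvPolynomial (Fin n ⊕ Fin l) k) (z : Fin n ⊕ Fin l → A) :
    Fin l → A :=
  fun i => MvPolynomial.aeval z (f i)

/-- The matrix `C = (∂f/∂y)(z)`. -/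
noncomputable def jacobianAt (f : Fin l → MvPolynomial (Fin n ⊕ Fin l) k)
    (z : Fin n ⊕ Fin l → A) : Matrix (Fin l) (Fin l) A :=
  (jacobian f).map (MvPolynomial.aeval z)

theorem aeval_map (φ : A →ₐ[k] B) (z : Fin n ⊕ Fin l → A)
    (g : MvPolynomial (Fin n ⊕ Fin l) k) :
    MvPolynomial.aeval (fun i => φ (z i)) g = φ (MvPolynomial.aeval z g) := by
  have := MvPolynomial.comp_aeval (R := k) z φ
  exact (DFunLike.congr_fun this g).symm

/-- Evaluation of `Ĉ f`, with `Ĉ` the adjugate matrix, commutes with homomorphisms. -/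
theorem adjugate_map (f : Fin l → MvPolynomial (Fin n ⊕ Fin l) k) (φ : A →ₐ[k] B)
    (z : Fin n ⊕ Fin l → A)
    (h : (jacobianAt f z).adjugate.mulVec (valAt f z) = 0) :
    (jacobianAt f (fun i => φ (z i))).adjugate.mulVec (valAt f (fun i => φ (z i))) = 0 := by
  have h1 : jacobianAt f (fun i => φ (z i)) = (φ : A →+* B).mapMatrix (jacobianAt f z) := by
    ext i j
    simp [jacobianAt, aeval_map]
  have h2 : valAt f (fun i => φ (z i)) = (φ : A →+* B) ∘ valAt f z := by
    ext i
    simp [valAt, aeval_map]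
  rw [h1, h2, ← RingHom.map_adjugate]
  ext i
  have := congrFun h i
  simp only [RingHom.mapMatrix_apply, Pi.zero_apply] at this ⊢
  rw [← RingHom.map_mulVec, this, map_zero]

end Equations

section Points

variable {k : Type u} [Field k] {n l : ℕ}

/-- A pair consisting of a monic polynomial `q ∈ R[t]` of degree `N` and an element `(z r)_r` of
`lim_r X(R[t]/(q ^ r))`, such that the scheme-theoretic preimage of `Δ_X` in `Spec R[t]/(q ^ 2)`
(the closed subscheme defined by the ideal generated by `Q(z 2)`) equals `Spec R[t]/(q)`. -/
structure ArcPoint (f : Fin l → MvPolynomial (Fin n ⊕ Fin l) k) (N : ℕ) (R : Type u)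
    [CommRing R] [Algebra k R] where
  q : R[X]
  monic : IsMonicDeg N q
  z : ∀ r : ℕ, Fin n ⊕ Fin l → Trunc q r
  mem : ∀ r, z r ∈ solutions f (Trunc q r)
  compat : ∀ r i, red k q (Nat.le_succ r) (z (r + 1) i) = z r i
  preimage : Ideal.span {MvPolynomial.aeval (z 2) (jacDet f)} = Ideal.span {cls q 2 q}

/-- The pair `(x mod q ^ (r - 1), y)` with entries in `R[t]/(q ^ (r - 1))`, where `r = s + 2`. -/
noncomputable def glue {R : Type u} [CommRing R] [Algebra k R] {s : ℕ} {q : R[X]}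
    (x : Fin n → Trunc q (s + 2)) (y : Fin l → Trunc q (s + 1)) :
    Fin n ⊕ Fin l → Trunc q (s + 1) :=
  Sum.elim (fun i => red k q (Nat.le_succ (s + 1)) (x i)) y

/-- The triples `(q, x, y)` that are the `R`-points of `Z_r`, where `r = s + 2`:
`q` is monic of degree `N`, `x` has entries in `R[t]/(q ^ r)` and `y` in `R[t]/(q ^ (r - 1))`. -/
structure NewtonPoint (f : Fin l → MvPolynomial (Fin n ⊕ Fin l) k) (N s : ℕ) (R : Type u)
    [CommRing R] [Algebra k R] where
  q : R[X]
  monic : IsMonicDeg N q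
  x : Fin n → Trunc q (s + 2)
  y : Fin l → Trunc q (s + 1)
  /-- `f(x, y) ≡ 0` modulo `q ^ (r - 1)` -/
  eqn : glue (k := k) x y ∈ solutions f (Trunc q (s + 1))
  /-- `Q(x, y) ≡ 0` modulo `q` -/
  det_zero : red k q (Nat.le_add_left 1 s)
    (MvPolynomial.aeval (glue (k := k) x y) (jacDet f)) = 0
  /-- `Ĉ f(x, y) ≡ 0` modulo `q ^ r`, where `Ĉ` is the adjugate of `C = (∂f/∂y)(x, y)`. It is
  expressed by a lift `y'` of `y` to `R[t]/(q ^ r)`; in the presence of the two previous conditions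
  the choice of the lift does not matter. -/
  adj : ∃ y' : Fin l → Trunc q (s + 2), (∀ j, red k q (Nat.le_succ (s + 1)) (y' j) = y j) ∧
    (jacobianAt f (Sum.elim x y')).adjugate.mulVec (valAt f (Sum.elim x y')) = 0
  /-- If `r ≥ 3`, then `q⁻¹ Q(x, y) ∈ R[t]/(q ^ (r - 2))` is invertible. -/
  unit : 3 ≤ s + 2 → ∃ v : Trunc q (s + 1),
    MvPolynomial.aeval (glue (k := k) x y) (jacDet f) = cls q (s + 1) q * v ∧
      IsUnit (red k q (Nat.le_succ s) v)

variable {f : Fin l → MvPolynomial (Fin n ⊕ Fin l) k} {N : ℕ}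

/-- Equality of points, tested on representatives in `R[t]`. -/
theorem ArcPoint.ext' {R : Type u} [CommRing R] [Algebra k R] {p p' : ArcPoint f N R}
    (hq : p.q = p'.q)
    (hz : ∀ r i, ∃ g : R[X], cls p.q r g = p.z r i ∧ cls p'.q r g = p'.z r i) : p = p' := by
  obtain ⟨q, _, z, _, _, _⟩ := p
  obtain ⟨q', _, z', _, _, _⟩ := p'
  obtain rfl : q = q' := hq
  obtain rfl : z = z' := by
    funext r i
    obtain ⟨g, h1, h2⟩ := hz r i
    exact h1.symm.trans h2
  rfl

/-- Equality of points, tested on representatives in `R[t]`. -/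
theorem NewtonPoint.ext' {s : ℕ} {R : Type u} [CommRing R] [Algebra k R]
    {p p' : NewtonPoint f N s R} (hq : p.q = p'.q)
    (hx : ∀ i, ∃ g : R[X], cls p.q (s + 2) g = p.x i ∧ cls p'.q (s + 2) g = p'.x i)
    (hy : ∀ i, ∃ g : R[X], cls p.q (s + 1) g = p.y i ∧ cls p'.q (s + 1) g = p'.y i) : p = p' := by
  obtain ⟨q, _, x, y, _, _, _, _⟩ := p
  obtain ⟨q', _, x', y', _, _, _, _⟩ := p'
  obtain rfl : q = q' := hq
  obtain rfl : x = x' := by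
    funext i
    obtain ⟨g, h1, h2⟩ := hx i
    exact h1.symm.trans h2
  obtain rfl : y = y' := by
    funext i
    obtain ⟨g, h1, h2⟩ := hy i
    exact h1.symm.trans h2
  rfl

variable {R S : Type u} [CommRing R] [Algebra k R] [CommRing S] [Algebra k S]

/-- The image of an `R`-point under a homomorphism `R → S`. -/
noncomputable def ArcPoint.map (φ : R →ₐ[k] S) (p : ArcPoint f N R) : ArcPoint f N S where
  q := p.q.map (φ : R →+* S)
  monic := p.monic.map φ
  z r i := baseChange φ p.q r (p.z r i)
  mem r i := by
    rw [aeval_map, p.mem r i, map_zero]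
  compat r i := by
    rw [red_baseChange, p.compat]
  preimage := by
    have h := congrArg (Ideal.map (baseChange φ p.q 2)) p.preimage
    rw [Ideal.map_span, Ideal.map_span, Set.image_singleton, Set.image_singleton] at h
    rw [aeval_map]
    exact h

theorem glue_baseChange {s : ℕ} (φ : R →ₐ[k] S) {q : R[X]} (x : Fin n → Trunc q (s + 2))
    (y : Fin l → Trunc q (s + 1)) :
    glue (k := k) (fun i => baseChange φ q (s + 2) (x i)) (fun i => baseChange φ q (s + 1) (y i)) =
    fun i => baseChange φ q (s + 1) (glue (k := k) x y i) := by
  funext i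
  rcases i with i | i
  · exact red_baseChange _ _ _ _
  · rfl

/-- The image of an `R`-point under a homomorphism `R → S`. -/
noncomputable def NewtonPoint.map {s : ℕ} (φ : R →ₐ[k] S) (p : NewtonPoint f N s R) :
    NewtonPoint f N s S where
  q := p.q.map (φ : R →+* S)
  monic := p.monic.map φ
  x i := baseChange φ p.q (s + 2) (p.x i)
  y i := baseChange φ p.q (s + 1) (p.y i)
  eqn i := by
    rw [glue_baseChange, aeval_map, p.eqn i, map_zero]
  det_zero := by
    rw [glue_baseChange, aeval_map, red_baseChange, p.det_zero, map_zero]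
  adj := by
    obtain ⟨y', h1, h2⟩ := p.adj
    refine ⟨fun j => baseChange φ p.q (s + 2) (y' j), fun j => ?_, ?_⟩
    · rw [red_baseChange, h1]
    · have h := adjugate_map f (baseChange φ p.q (s + 2)) _ h2
      have e : (fun i => baseChange φ p.q (s + 2) (Sum.elim p.x y' i)) =
          Sum.elim (fun i => baseChange φ p.q (s + 2) (p.x i))
            (fun j => baseChange φ p.q (s + 2) (y' j)) := by
        funext i; rcases i with i | i <;> rfl
      rwa [e] at h
  unit hs := by
    obtain ⟨v, h1, h2⟩ := p.unit hs
    refine ⟨baseChange φ p.q (s + 1) v, ?_, ?_⟩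
    · rw [glue_baseChange, aeval_map, h1, map_mul, baseChange_cls]
    · rw [red_baseChange]
      exact h2.map _

theorem glue_trunc {s : ℕ} {q : R[X]} (x : Fin n → Trunc q (s + 1 + 2))
    (y : Fin l → Trunc q (s + 1 + 1)) :
    glue (k := k) (fun i => red k q (Nat.le_succ (s + 2)) (x i))
      (fun i => red k q (Nat.le_succ (s + 1)) (y i)) =
    fun i => red k q (Nat.le_succ (s + 1)) (glue (k := k) x y i) := by
  funext i
  rcases i with i | i <;> rfl

/-- The truncation `(q, x, y) ↦ (q, x mod q ^ r, y mod q ^ (r - 1))` from `Z_(r+1)` to `Z_r`,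
where `r = s + 2`. -/
noncomputable def NewtonPoint.trunc {s : ℕ} (p : NewtonPoint f N (s + 1) R) :
    NewtonPoint f N s R where
  q := p.q
  monic := p.monic
  x i := red k p.q (Nat.le_succ (s + 2)) (p.x i)
  y i := red k p.q (Nat.le_succ (s + 1)) (p.y i)
  eqn i := by
    rw [glue_trunc, aeval_map, p.eqn i, map_zero]
  det_zero := by
    rw [glue_trunc, aeval_map, red_red]
    exact p.det_zero
  adj := by
    obtain ⟨y', h1, h2⟩ := p.adj
    refine ⟨p.y, fun j => rfl, ?_⟩
    have h := adjugate_map f (red k p.q (Nat.le_succ (s + 2))) _ h2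
    have e : (fun i => red k p.q (Nat.le_succ (s + 2)) (Sum.elim p.x y' i)) =
        Sum.elim (fun i => red k p.q (Nat.le_succ (s + 2)) (p.x i)) p.y := by
      funext i
      rcases i with i | i
      · rfl
      · exact h1 i
    rwa [e] at h
  unit _ := by
    obtain ⟨v, h1, h2⟩ := p.unit (Nat.le_add_left 3 s)
    refine ⟨red k p.q (Nat.le_succ (s + 1)) v, ?_, ?_⟩
    · rw [glue_trunc, aeval_map, h1, map_mul, red_cls]
    · have h := h2.map (red k p.q (Nat.le_succ s))
      rwa [red_red] at h ⊢

theorem ArcPoint.red_z (p : ArcPoint f N R) {r s : ℕ} (h : s ≤ r) (i : Fin n ⊕ Fin l) :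
    red k p.q h (p.z r i) = p.z s i := by
  induction r, h using Nat.le_induction with
  | base =>
    obtain ⟨g, hg⟩ := cls_surjective p.q s (p.z s i)
    rw [← hg, red_cls]
  | succ r hr ih => rw [← ih, ← p.compat r i, red_red]

theorem ArcPoint.glue_z (p : ArcPoint f N R) (s : ℕ) :
    glue (k := k) (fun i => p.z (s + 2) (Sum.inl i))
      (fun i => red k p.q (Nat.le_succ (s + 1)) (p.z (s + 2) (Sum.inr i))) = p.z (s + 1) := by
  funext i
  rcases i with i | i <;> exact p.compat _ _

theorem ArcPoint.red_jacDet (p : ArcPoint f N R) {r s : ℕ} (h : s ≤ r) :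
    red k p.q h (MvPolynomial.aeval (p.z r) (jacDet f)) =
      MvPolynomial.aeval (p.z s) (jacDet f) := by
  rw [← aeval_map]
  simp only [p.red_z h]

/-- `Q(z r) = q v` with `v` a unit modulo every power of `q`. -/
theorem ArcPoint.exists_unit (p : ArcPoint f N R) (s : ℕ) :
    ∃ v : R[X], MvPolynomial.aeval (p.z s) (jacDet f) = cls p.q s (p.q * v) ∧
      ∀ r, IsUnit (cls p.q r v) := by
  obtain ⟨G, hG⟩ := cls_surjective p.q (s + 2) (MvPolynomial.aeval (p.z (s + 2)) (jacDet f))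
  have h2 : MvPolynomial.aeval (p.z 2) (jacDet f) = cls p.q 2 G := by
    rw [← p.red_jacDet (Nat.le_add_left 2 s), ← hG, red_cls]
  have hs : MvPolynomial.aeval (p.z s) (jacDet f) = cls p.q s G := by
    rw [← p.red_jacDet (Nat.le_add_right s 2), ← hG, red_cls]
  have hp := p.preimage
  rw [h2] at hp
  have m1 : cls p.q 2 G ∈ Ideal.span {cls p.q 2 p.q} := hp ▸ Ideal.mem_span_singleton_self _
  have m2 : cls p.q 2 p.q ∈ Ideal.span {cls p.q 2 G} := hp ▸ Ideal.mem_span_singleton_self _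
  obtain ⟨a, ha⟩ := Ideal.mem_span_singleton.1 m1
  obtain ⟨b, hb⟩ := Ideal.mem_span_singleton.1 m2
  obtain ⟨a, rfl⟩ := cls_surjective _ _ a
  obtain ⟨b, rfl⟩ := cls_surjective _ _ b
  rw [← map_mul] at ha hb
  obtain ⟨c, hc⟩ := Ideal.mem_span_singleton.1 (Ideal.Quotient.eq.1 ha)
  obtain ⟨d, hd⟩ := Ideal.mem_span_singleton.1 (Ideal.Quotient.eq.1 hb)
  have hmon : p.q.Monic := Polynomial.monic_of_natDegree_le_of_coeff_eq_one N p.monic.1 p.monic.2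
  have hGv : G = p.q * (a + p.q * c) := by linear_combination hc
  have hcop : (a + p.q * c) * b + p.q * d = 1 := by
    refine hmon.isRegular.left ?_
    show p.q * _ = p.q * 1
    rw [hGv] at hd
    linear_combination -hd
  refine ⟨a + p.q * c, by rw [hs, hGv], fun r => ?_⟩
  have hc' : IsCoprime (a + p.q * c) (p.q ^ r) :=
    IsCoprime.pow_right ⟨b, d, by linear_combination hcop⟩
  obtain ⟨u, w, huw⟩ := hc'
  refine IsUnit.of_mul_eq_one (cls p.q r u) ?_
  rw [← map_mul, ← map_one (cls p.q r)]
  exact Ideal.Quotient.eq.2 (Ideal.mem_span_singleton.2 ⟨-w, by linear_combination huw⟩)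

/-- The truncation `(q, (x_r, y_r)_r) ↦ (q, x_r, y_r mod q ^ (r - 1))` from `Z` to `Z_r`,
where `r = s + 2`. -/
noncomputable def ArcPoint.trunc (s : ℕ) (p : ArcPoint f N R) : NewtonPoint f N s R where
  q := p.q
  monic := p.monic
  x i := p.z (s + 2) (Sum.inl i)
  y i := red k p.q (Nat.le_succ (s + 1)) (p.z (s + 2) (Sum.inr i))
  eqn := by
    rw [p.glue_z]
    exact p.mem _
  det_zero := by
    rw [p.glue_z, p.red_jacDet]
    obtain ⟨v, hv, -⟩ := p.exists_unit 1
    rw [hv]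
    exact Ideal.Quotient.eq_zero_iff_mem.2 (Ideal.mem_span_singleton.2 ⟨v, by ring⟩)
  adj := by
    refine ⟨fun j => p.z (s + 2) (Sum.inr j), fun j => rfl, ?_⟩
    have e : Sum.elim (fun i => p.z (s + 2) (Sum.inl i)) (fun j => p.z (s + 2) (Sum.inr j)) =
        p.z (s + 2) := by
      funext i; rcases i with i | i <;> rfl
    have h : valAt f (p.z (s + 2)) = 0 := funext (p.mem (s + 2))
    rw [e, h, Matrix.mulVec_zero]
  unit _ := by
    obtain ⟨v, hv, hu⟩ := p.exists_unit (s + 1)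
    refine ⟨cls p.q (s + 1) v, ?_, ?_⟩
    · rw [p.glue_z, hv, map_mul]
    · rw [red_cls]
      exact hu s

variable (f N)

/-- The functor of pairs `(q, (z r)_r)` on `k`-algebras. -/
noncomputable def arcFunctor : CommAlgCat.{u} k ⥤ Type u where
  obj R := ArcPoint f N R
  map φ := ↾fun p => p.map φ.hom
  map_id R := by
    ext p
    refine ArcPoint.ext' (Polynomial.map_id ..) fun r i => ?_
    obtain ⟨g, hg⟩ := cls_surjective p.q r (p.z r i)
    exact ⟨g, (congrArg (cls _ r) (Polynomial.map_id ..).symm).trans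
      (congrArg (baseChange (AlgHom.id k R) p.q r) hg), hg⟩
  map_comp {R S T} φ ψ := by
    ext p
    refine ArcPoint.ext' (Polynomial.map_map ..).symm fun r i => ?_
    obtain ⟨g, hg⟩ := cls_surjective p.q r (p.z r i)
    exact ⟨g.map ((ψ.hom.comp φ.hom : R →ₐ[k] T) : R →+* T),
      congrArg (baseChange (ψ.hom.comp φ.hom) p.q r) hg,
      (congrArg (cls _ r) (Polynomial.map_map ..).symm).trans
      (congrArg (fun a => baseChange ψ.hom _ r (baseChange φ.hom p.q r a)) hg)⟩

/-- The functor of points of `Z_r` on `k`-algebras, where `r = s + 2`. -/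
noncomputable def newtonFunctor (s : ℕ) : CommAlgCat.{u} k ⥤ Type u where
  obj R := NewtonPoint f N s R
  map φ := ↾fun p => p.map φ.hom
  map_id R := by
    ext p
    refine NewtonPoint.ext' (Polynomial.map_id ..) (fun i => ?_) (fun i => ?_)
    · obtain ⟨g, hg⟩ := cls_surjective p.q _ (p.x i)
      exact ⟨g, (congrArg (cls _ _) (Polynomial.map_id ..).symm).trans
        (congrArg (baseChange (AlgHom.id k R) p.q _) hg), hg⟩
    · obtain ⟨g, hg⟩ := cls_surjective p.q _ (p.y i)
      exact ⟨g, (congrArg (cls _ _) (Polynomial.map_id ..).symm).trans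
        (congrArg (baseChange (AlgHom.id k R) p.q _) hg), hg⟩
  map_comp {R S T} φ ψ := by
    ext p
    refine NewtonPoint.ext' (Polynomial.map_map ..).symm (fun i => ?_) (fun i => ?_)
    · obtain ⟨g, hg⟩ := cls_surjective p.q _ (p.x i)
      exact ⟨g.map ((ψ.hom.comp φ.hom : R →ₐ[k] T) : R →+* T),
        congrArg (baseChange (ψ.hom.comp φ.hom) p.q _) hg,
        (congrArg (cls _ _) (Polynomial.map_map ..).symm).trans
        (congrArg (fun a => baseChange ψ.hom _ _ (baseChange φ.hom p.q _ a)) hg)⟩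
    · obtain ⟨g, hg⟩ := cls_surjective p.q _ (p.y i)
      exact ⟨g.map ((ψ.hom.comp φ.hom : R →ₐ[k] T) : R →+* T),
        congrArg (baseChange (ψ.hom.comp φ.hom) p.q _) hg,
        (congrArg (cls _ _) (Polynomial.map_map ..).symm).trans
        (congrArg (fun a => baseChange ψ.hom _ _ (baseChange φ.hom p.q _ a)) hg)⟩

/-- The truncations `Z_(r+1) → Z_r`, as a map of functors, where `r = s + 2`. -/
noncomputable def newtonTrunc (s : ℕ) : newtonFunctor f N (s + 1) ⟶ newtonFunctor f N s where
  app R := ↾fun p => p.trunc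
  naturality R S φ := by
    ext p
    refine NewtonPoint.ext' rfl (fun i => ?_) (fun i => ?_)
    · obtain ⟨g, hg⟩ := cls_surjective _ _ (p.x i)
      exact ⟨g.map (φ.hom : R →+* S),
        congrArg (fun a => red k _ (Nat.le_succ (s + 2)) (baseChange φ.hom p.q _ a)) hg,
        congrArg (fun a => baseChange φ.hom p.q _ (red k _ (Nat.le_succ (s + 2)) a)) hg⟩
    · obtain ⟨g, hg⟩ := cls_surjective _ _ (p.y i)
      exact ⟨g.map (φ.hom : R →+* S),
        congrArg (fun a => red k _ (Nat.le_succ (s + 1)) (baseChange φ.hom p.q _ a)) hg,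
        congrArg (fun a => baseChange φ.hom p.q _ (red k _ (Nat.le_succ (s + 1)) a)) hg⟩

/-- The truncations `Z → Z_r`, as a map of functors, where `r = s + 2`. -/
noncomputable def arcTrunc (s : ℕ) : arcFunctor f N ⟶ newtonFunctor f N s where
  app R := ↾fun p => p.trunc s
  naturality R S φ := by
    ext p
    refine NewtonPoint.ext' rfl (fun i => ?_) (fun i => ?_)
    · obtain ⟨g, hg⟩ := cls_surjective _ _ (p.z (s + 2) (Sum.inl i))
      exact ⟨g.map (φ.hom : R →+* S), congrArg (fun a => baseChange φ.hom p.q _ a) hg,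
        congrArg (fun a => baseChange φ.hom p.q _ a) hg⟩
    · obtain ⟨g, hg⟩ := cls_surjective _ _ (p.z (s + 2) (Sum.inr i))
      exact ⟨g.map (φ.hom : R →+* S),
        congrArg (fun a => red k _ (Nat.le_succ (s + 1)) (baseChange φ.hom p.q _ a)) hg,
        congrArg (fun a => baseChange φ.hom p.q _ (red k _ (Nat.le_succ (s + 1)) a)) hg⟩

variable (k) in
/-- The functor of points `R ↦ Hom_k(Spec R, Z)` of `k`-schemes `Z`, restricted to `k`-algebras. -/
noncomputable def pointFunctor : Over (Spec (CommRingCat.of k)) ⥤ CommAlgCat.{u} k ⥤ Type u :=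
  yoneda ⋙ (Functor.whiskeringLeft _ _ _).obj (algSpec (CommRingCat.of k)).rightOp

variable (k) in
/-- The affine space `𝔸^I` over `k` with coordinates indexed by `I`. -/
noncomputable def affineSpace (I : Type) : Over (Spec (CommRingCat.of k)) :=
  Over.mk (𝔸(ULift.{u} I; Spec (CommRingCat.of k)) ↘ Spec (CommRingCat.of k))

end Points

/-- A sequence of compatible morphisms `π s : Z ⟶ X s` as a cone over the tower
`⋯ ⟶ X 2 ⟶ X 1 ⟶ X 0` with transition morphisms `τ s`. -/
def towerCone {C : Type*} [Category* C] {X : ℕ → C} (τ : ∀ s, X (s + 1) ⟶ X s) {Z : C}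
    (π : ∀ s, Z ⟶ X s) (h : ∀ s, π (s + 1) ≫ τ s = π s) : Cone (Functor.ofOpSequence τ) where
  pt := Z
  π := NatTrans.ofOpSequence π (fun s => by
    rw [Functor.ofOpSequence_map_homOfLE_succ]
    exact (Category.id_comp _).trans (h s).symm)

end NewtonArc

/-! A point of Z_r, r = s + 2, is represented by polynomials over R[t]: a monic q and a vector z =
(x, y) satisfying divisibilities by powers of q (`IsNewton`). Everything rests on Newton's method
for the equation Ĉ f = 0 in y. By the product rule the y-derivative of Ĉ f is Ĉ C + (∂Ĉ) f = Q · 1 +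
(∂Ĉ) f, and f is divisible by q ^ (r - 1). Write Q = q w and Ĉ f = q ^ r h. For r ≥ 3, replacing y
by y + q ^ (r - 1) δ changes Ĉ f into q ^ r (h + w δ) modulo q ^ (r + 1) (`newton_step`). As w is
invertible modulo q, exactly one δ modulo q makes this vanish, and f ≡ 0 mod q ^ r then follows from
C Ĉ = Q (`IsNewton.of_adj`). So every lift of x modulo q ^ (r + 1) comes with exactly one lift of y
modulo q ^ r. Lifts of x are parametrized by the next digit in base q, that is, by n N free
coefficients. This gives the product decomposition for r ≥ 3
(`NewtonPoint.existsUnique_of_trunc_digits`), and iterating it from Z_3 gives Z = Z_3 × (affine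
space).

For r = 2, the invertibility of w is not a condition on Z_2, and the error terms are no longer
negligible. Along a square-zero extension they are: if a lift is given over the quotient, the
relevant cofactors are divisible by q up to nilpotents of square zero, hence their products are
divisible by q (`dvd_mul_of_map_dvd`). Thus lifts are unique infinitesimally
(`NewtonPoint.existsUnique_lift`), and in all cases Z_(r+1) is étale over Z_r × 𝔸^(n N). Smoothness
follows, and a nonempty fiber, being étale over an affine space of dimension n N, has that
dimension.

Representability comes from division with remainder: modulo a monic polynomial, classes have unique
coefficient vectors, and divisibility is a polynomial condition on coefficients. Finally `Spec` is
fully faithful on k-algebras and preserves limits, so statements about functors on algebras become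
statements about schemes. -/

namespace NewtonArc

/-! ### Taylor expansion modulo the square of an ideal -/

section Expansion

variable {k P σ : Type*} [CommRing k] [CommRing P] [Algebra k P]

theorem aeval_add_sub_mem (J : Ideal P) (z d : σ → P) (hd : ∀ i, d i ∈ J)
    (F : MvPolynomial σ k) :
    MvPolynomial.aeval (z + d) F - MvPolynomial.aeval z F ∈ J := by
  rw [← Ideal.Quotient.eq]
  have h : ∀ w : σ → P, Ideal.Quotient.mk J (MvPolynomial.aeval w F) =
      MvPolynomial.aeval (fun i => Ideal.Quotient.mk J (w i)) F := fun w =>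
    DFunLike.congr_fun (MvPolynomial.comp_aeval (R := k) w (Ideal.Quotient.mkₐ k J)) F
  rw [h, h]
  congr 2
  funext i
  simpa using Ideal.Quotient.eq_zero_iff_mem.2 (hd i)

/-- The Taylor expansion of order two of a polynomial in several variables. -/
theorem aeval_add_sub_sum_pderiv_mem [Fintype σ] (J : Ideal P) (z d : σ → P)
    (hd : ∀ i, d i ∈ J) (F : MvPolynomial σ k) :
    MvPolynomial.aeval (z + d) F - MvPolynomial.aeval z F -
      ∑ i, MvPolynomial.aeval z (MvPolynomial.pderiv i F) * d i ∈ J ^ 2 := by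
  classical
  induction F using MvPolynomial.induction_on with
  | C a => simp
  | add p q hp hq =>
    convert! add_mem hp hq using 1
    simp only [map_add, add_mul, Finset.sum_add_distrib]
    ring
  | mul_X p j hp =>
    have h1 : (MvPolynomial.aeval (z + d) p - MvPolynomial.aeval z p) * d j ∈ J ^ 2 := by
      rw [pow_two]
      exact Ideal.mul_mem_mul (aeval_add_sub_mem J z d hd p) (hd j)
    convert! add_mem (Ideal.mul_mem_right (z j) _ hp) h1 using 1
    have h2 : ∑ i, MvPolynomial.aeval z (MvPolynomial.pderiv i (p * MvPolynomial.X j)) * d i =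
        (∑ i, MvPolynomial.aeval z (MvPolynomial.pderiv i p) * d i) * z j +
          MvPolynomial.aeval z p * d j := by
      simp only [Derivation.leibniz, smul_eq_mul, map_add, map_mul, add_mul,
        Finset.sum_add_distrib, MvPolynomial.aeval_X, MvPolynomial.pderiv_X]
      rw [add_comm, Finset.sum_mul]
      congr 1
      · exact Finset.sum_congr rfl fun i _ => by ring
      · rw [Finset.sum_eq_single j]
        · simp
        · intro b _ hb
          simp [hb.symm]
        · simp
    rw [h2]
    simp only [map_mul, MvPolynomial.aeval_X, Pi.add_apply]
    ring

end Expansion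

/-! ### Newton's method for Ĉ f over an arbitrary ring -/

section Newton

variable {k : Type u} [Field k] {n l : ℕ} {P P' : Type u} [CommRing P] [Algebra k P]
  [CommRing P'] [Algebra k P']

variable (f : Fin l → MvPolynomial (Fin n ⊕ Fin l) k)

/-- The vector `Ĉ f` of polynomials, with `Ĉ` the adjugate of `∂f/∂y`. -/
noncomputable def newtonPoly : Fin l → MvPolynomial (Fin n ⊕ Fin l) k :=
  (jacobian f).adjugate.mulVec f

theorem jacobianAt_eq (z : Fin n ⊕ Fin l → P) :
    jacobianAt f z = (MvPolynomial.aeval (R := k) z).toRingHom.mapMatrix (jacobian f) := rfl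

theorem det_jacobianAt (z : Fin n ⊕ Fin l → P) :
    (jacobianAt f z).det = MvPolynomial.aeval z (jacDet f) := by
  rw [jacobianAt_eq, ← RingHom.map_det]
  rfl

theorem aeval_newtonPoly (z : Fin n ⊕ Fin l → P) (i : Fin l) :
    MvPolynomial.aeval z (newtonPoly f i) =
      (jacobianAt f z).adjugate.mulVec (valAt f z) i := by
  rw [jacobianAt_eq, ← RingHom.map_adjugate]
  exact RingHom.map_mulVec (MvPolynomial.aeval (R := k) z).toRingHom _ _ _

/-- The identity C Ĉ = Q · 1, used to recover f from Ĉ f. -/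
theorem jacobianAt_mulVec_newtonPoly (z : Fin n ⊕ Fin l → P) (i : Fin l) :
    (jacobianAt f z).mulVec (fun j => MvPolynomial.aeval z (newtonPoly f j)) i =
      MvPolynomial.aeval z (jacDet f) * MvPolynomial.aeval z (f i) := by
  have h : (fun j => MvPolynomial.aeval z (newtonPoly f j)) =
      (jacobianAt f z).adjugate.mulVec (valAt f z) := funext (aeval_newtonPoly f z)
  rw [h, Matrix.mulVec_mulVec, Matrix.mul_adjugate, Matrix.smul_mulVec, Matrix.one_mulVec,
    det_jacobianAt]
  rfl

/-- The change of `Ĉ f` under a change of the `y`-variables. -/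
theorem aeval_newtonPoly_add_sub_mem (J : Ideal P) (z : Fin n ⊕ Fin l → P) (d : Fin l → P)
    (hd : ∀ i, d i ∈ J) (i : Fin l) :
    MvPolynomial.aeval (z + Sum.elim (0 : Fin n → P) d) (newtonPoly f i) -
      MvPolynomial.aeval z (newtonPoly f i) - MvPolynomial.aeval z (jacDet f) * d i ∈
      J ^ 2 + J * Ideal.span (Set.range (valAt f z)) := by
  have h1 := aeval_add_sub_sum_pderiv_mem (k := k) J z (Sum.elim (0 : Fin n → P) d)
    (by rintro (i | i) <;> simp [hd]) (newtonPoly f i)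
  rw [Fintype.sum_sum_type] at h1
  simp only [Sum.elim_inl, Pi.zero_apply, mul_zero, Finset.sum_const_zero, zero_add,
    Sum.elim_inr] at h1
  -- Product rule: the linear term is Ĉ C d + (∂Ĉ · d) f. Its first part is Q d, and its second part
  -- lies in J times the ideal of the values of f.
  have h2 : ∑ j, MvPolynomial.aeval z (MvPolynomial.pderiv (Sum.inr j) (newtonPoly f i)) * d j -
      MvPolynomial.aeval z (jacDet f) * d i ∈ J * Ideal.span (Set.range (valAt f z)) := by
    have h3 : ∀ j, MvPolynomial.aeval z (MvPolynomial.pderiv (Sum.inr j) (newtonPoly f i)) =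
        ((jacobianAt f z).adjugate * jacobianAt f z) i j +
        ∑ m, MvPolynomial.aeval z (MvPolynomial.pderiv (Sum.inr j) ((jacobian f).adjugate i m)) *
          valAt f z m := by
      intro j
      rw [jacobianAt_eq, ← RingHom.map_adjugate, Matrix.mul_apply, ← Finset.sum_add_distrib]
      simp only [newtonPoly, Matrix.mulVec, dotProduct, map_sum, Derivation.leibniz,
        smul_eq_mul, map_add, map_mul]
      refine Finset.sum_congr rfl fun m _ => ?_
      rw [mul_comm (MvPolynomial.aeval z (f m))]
      rfl
    simp only [h3, Matrix.adjugate_mul, det_jacobianAt, add_mul, Finset.sum_add_distrib]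
    rw [Finset.sum_eq_single i (by
      intro b _ hb
      simp [Matrix.one_apply_ne hb.symm]) (by simp)]
    simp only [Matrix.smul_apply, Matrix.one_apply_eq, smul_eq_mul, mul_one, add_sub_cancel_left]
    refine sum_mem fun j _ => ?_
    rw [Finset.sum_mul]
    refine sum_mem fun m _ => ?_
    rw [mul_comm _ (d j)]
    exact Ideal.mul_mem_mul (hd j)
      (Ideal.mul_mem_left _ _ (Ideal.subset_span (Set.mem_range_self m)))
  have := add_mem (Ideal.mem_sup_left h1 : _ ∈ J ^ 2 ⊔ J * Ideal.span (Set.range (valAt f z)))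
    (Ideal.mem_sup_right h2)
  convert! this using 1
  ring

/-- One step of Newton's method: the change of `Ĉ f` when `y` is replaced by `y + q a δ`. -/
theorem newton_step {q a w : P} {z : Fin n ⊕ Fin l → P} {δ g h : Fin l → P}
    (hg : ∀ i, MvPolynomial.aeval z (f i) = q * a * g i)
    (hw : MvPolynomial.aeval z (jacDet f) = q * w)
    (hh : ∀ i, MvPolynomial.aeval z (newtonPoly f i) = q ^ 2 * a * h i)
    (hδ : ∀ i j, q ∣ a * δ i * δ j) (hδg : ∀ i j, q ∣ a * δ i * g j) (i : Fin l) :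
    q ^ 3 * a ∣ MvPolynomial.aeval (z + Sum.elim (0 : Fin n → P) (fun j => q * a * δ j)) (newtonPoly f i) -
      q ^ 2 * a * (h i + w * δ i) := by
  set J : Ideal P := Ideal.span (Set.range fun j => q * a * δ j) with hJ
  have h1 := aeval_newtonPoly_add_sub_mem f J z (fun j => q * a * δ j)
    (fun j => Ideal.subset_span (Set.mem_range_self j)) i
  -- The errors are generated by (q a)² δ_j δ_m and (q a)² δ_j g_m. One factor a is absorbed by `hδ`
  -- or `hδg` and turned into a factor q.
  have h2 : J ^ 2 ⊔ J * Ideal.span (Set.range (valAt f z)) ≤ Ideal.span {q ^ 3 * a} := by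
    refine sup_le ?_ ?_
    · rw [pow_two, hJ, Ideal.span_mul_span', Ideal.span_le]
      rintro _ ⟨_, ⟨j, rfl⟩, _, ⟨m, rfl⟩, rfl⟩
      obtain ⟨c, hc⟩ := hδ j m
      refine Ideal.mem_span_singleton.2 ⟨c, ?_⟩
      simp only
      linear_combination q ^ 2 * a * hc
    · rw [hJ, Ideal.span_mul_span', Ideal.span_le]
      rintro _ ⟨_, ⟨j, rfl⟩, _, ⟨m, rfl⟩, rfl⟩
      obtain ⟨c, hc⟩ := hδg j m
      refine Ideal.mem_span_singleton.2 ⟨c, ?_⟩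
      simp only [valAt, hg]
      linear_combination q ^ 2 * a * hc
  obtain ⟨c, hc⟩ := Ideal.mem_span_singleton.1 (h2 h1)
  refine ⟨c, ?_⟩
  rw [hh, hw] at hc
  linear_combination hc

/-- The equations of the points of the `r`-th truncation, `r = s + 2`, for elements of a ring. -/
structure IsNewton (s : ℕ) (q : P) (z : Fin n ⊕ Fin l → P) : Prop where
  eqn : ∀ i, q ^ (s + 1) ∣ MvPolynomial.aeval z (f i)
  det : ∃ w, MvPolynomial.aeval z (jacDet f) = q * w ∧ (1 ≤ s → IsCoprime w q)
  adj : ∀ i, q ^ (s + 2) ∣ MvPolynomial.aeval z (newtonPoly f i)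

variable {f}

theorem IsNewton.map {s : ℕ} {q : P} {z : Fin n ⊕ Fin l → P} (h : IsNewton f s q z)
    (φ : P →ₐ[k] P') : IsNewton f s (φ q) (fun i => φ (z i)) where
  eqn i := by
    rw [aeval_map, ← map_pow]
    exact map_dvd φ (h.eqn i)
  det := by
    obtain ⟨w, hw, hc⟩ := h.det
    exact ⟨φ w, by rw [aeval_map, hw, map_mul], fun hs => (hc hs).map (φ : P →+* P')⟩
  adj i := by
    rw [aeval_map, ← map_pow]
    exact map_dvd φ (h.adj i)

theorem IsNewton.of_succ {s : ℕ} {q : P} {z : Fin n ⊕ Fin l → P} (h : IsNewton f (s + 1) q z) :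
    IsNewton f s q z where
  eqn i := (pow_dvd_pow _ (Nat.le_succ _)).trans (h.eqn i)
  det := by
    obtain ⟨w, hw, hc⟩ := h.det
    exact ⟨w, hw, fun _ => hc (Nat.le_add_left 1 s)⟩
  adj i := (pow_dvd_pow _ (Nat.le_succ _)).trans (h.adj i)

/-- Independence of the representatives. The condition on Ĉ f modulo q ^ (s + 2) survives although y
is only known modulo q ^ (s + 1), because the y-derivative of Ĉ f is Q up to multiples of f, and Q
is divisible by q. -/
theorem IsNewton.add {s : ℕ} {q : P} {z d : Fin n ⊕ Fin l → P} (h : IsNewton f s q z)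
    (hx : ∀ i, q ^ (s + 2) ∣ d (Sum.inl i)) (hy : ∀ i, q ^ (s + 1) ∣ d (Sum.inr i)) :
    IsNewton f s q (z + d) := by
  have hd : ∀ i, d i ∈ Ideal.span {q ^ (s + 1)} := by
    rintro (i | i)
    · exact Ideal.mem_span_singleton.2 ((pow_dvd_pow _ (Nat.le_succ _)).trans (hx i))
    · exact Ideal.mem_span_singleton.2 (hy i)
  have key : ∀ F : MvPolynomial (Fin n ⊕ Fin l) k,
      q ^ (s + 1) ∣ MvPolynomial.aeval (z + d) F - MvPolynomial.aeval z F := fun F =>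
    Ideal.mem_span_singleton.1 (aeval_add_sub_mem _ z d hd F)
  refine ⟨fun i => ?_, ?_, fun i => ?_⟩
  · simpa using dvd_add (key (f i)) (h.eqn i)
  · obtain ⟨w, hw, hc⟩ := h.det
    obtain ⟨c, hc'⟩ := key (jacDet f)
    refine ⟨w + q ^ s * c, by rw [hw] at hc'; linear_combination hc', fun hs => ?_⟩
    obtain ⟨m, rfl⟩ := Nat.exists_eq_add_of_le' hs
    rw [pow_succ', mul_assoc]
    exact (hc hs).add_mul_left_left _
  -- First y is moved, then x. The errors in the y-step are divisible by q ^ (2 s + 2), and 2 s + 2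
  -- ≥ s + 2.
  · set z₁ : Fin n ⊕ Fin l → P := z + Sum.elim (0 : Fin n → P) (fun j => d (Sum.inr j)) with hz₁
    have e : z + d = z₁ + Sum.elim (fun j => d (Sum.inl j)) (0 : Fin l → P) := by
      funext j
      rcases j with j | j <;> simp [hz₁]
    have h1 : q ^ (s + 2) ∣ MvPolynomial.aeval (z + d) (newtonPoly f i) -
        MvPolynomial.aeval z₁ (newtonPoly f i) := by
      rw [e]
      refine Ideal.mem_span_singleton.1 (aeval_add_sub_mem _ z₁ _ ?_ _)
      rintro (j | j)
      · exact Ideal.mem_span_singleton.2 (hx j)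
      · simp
    have h2 := aeval_newtonPoly_add_sub_mem f (Ideal.span {q ^ (s + 1)}) z
      (fun j => d (Sum.inr j)) (fun j => hd _) i
    have h3 : Ideal.span {q ^ (s + 1)} ^ 2 ⊔ Ideal.span {q ^ (s + 1)} *
        Ideal.span (Set.range (valAt f z)) ≤ Ideal.span {q ^ (s + 2)} := by
      have h4 : Ideal.span (Set.range (valAt f z)) ≤ Ideal.span {q ^ (s + 1)} := by
        rw [Ideal.span_le]
        rintro _ ⟨j, rfl⟩
        exact Ideal.mem_span_singleton.2 (h.eqn j)
      have h5 : Ideal.span {q ^ (s + 1)} * Ideal.span {q ^ (s + 1)} ≤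
          Ideal.span {q ^ (s + 2)} := by
        rw [Ideal.span_singleton_mul_span_singleton, ← pow_add,
          Ideal.span_singleton_le_span_singleton]
        exact pow_dvd_pow _ (by omega)
      refine sup_le ((pow_two _).trans_le h5) ((Ideal.mul_mono_right h4).trans h5)
    have h6 := Ideal.mem_span_singleton.1 (h3 h2)
    obtain ⟨w, hw, -⟩ := h.det
    have h7 : q ^ (s + 2) ∣ MvPolynomial.aeval z (jacDet f) * d (Sum.inr i) := by
      rw [hw, pow_succ' q (s + 1)]
      exact mul_dvd_mul (dvd_mul_right _ _) (hy i)
    have := dvd_add (dvd_add (dvd_add h1 h6) h7) (h.adj i)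
    rw [← hz₁] at this
    convert this using 1
    ring

theorem IsNewton.congr {s : ℕ} {q : P} {z z' : Fin n ⊕ Fin l → P} (h : IsNewton f s q z)
    (hx : ∀ i, q ^ (s + 2) ∣ z' (Sum.inl i) - z (Sum.inl i))
    (hy : ∀ i, q ^ (s + 1) ∣ z' (Sum.inr i) - z (Sum.inr i)) : IsNewton f s q z' := by
  have := h.add (d := z' - z) hx hy
  rwa [add_sub_cancel] at this

/-- If `q⁻¹ Q(z)` is invertible modulo `q`, then the equation `Ĉ f ≡ 0` implies `f ≡ 0`. -/
theorem IsNewton.of_adj {s : ℕ} {q w : P} (hq : IsLeftRegular q) {z : Fin n ⊕ Fin l → P}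
    (hw : MvPolynomial.aeval z (jacDet f) = q * w) (hc : IsCoprime w q)
    (h : ∀ i, q ^ (s + 2) ∣ MvPolynomial.aeval z (newtonPoly f i)) : IsNewton f s q z := by
  refine ⟨fun i => ?_, ⟨w, hw, fun _ => hc⟩, h⟩
  have h1 : q ^ (s + 2) ∣ q * w * MvPolynomial.aeval z (f i) := by
    rw [← hw, ← jacobianAt_mulVec_newtonPoly]
    simp only [Matrix.mulVec, dotProduct]
    exact Finset.dvd_sum fun j _ => Dvd.dvd.mul_left (h j) _
  obtain ⟨c, hc'⟩ := h1
  have h2 : w * MvPolynomial.aeval z (f i) = q ^ (s + 1) * c := hq (by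
    simp only
    linear_combination hc')
  exact (hc.pow_right (n := s + 1)).symm.dvd_of_dvd_mul_left ⟨c, h2⟩

/-- The uniqueness part of Newton's method. -/
theorem IsNewton.dvd_of_add {s : ℕ} {q : P} (hq : IsLeftRegular q) {z : Fin n ⊕ Fin l → P}
    {δ : Fin l → P} (h : IsNewton f (s + 1) q z)
    (h' : IsNewton f (s + 1) q (z + Sum.elim (0 : Fin n → P) (fun j => q ^ (s + 1) * δ j)))
    (hδ : ∀ i j, q ∣ q ^ s * δ i * δ j) (i : Fin l) : q ∣ δ i := by
  choose g hg using h.eqn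
  choose e he using h.adj
  obtain ⟨w, hw, hc⟩ := h.det
  -- At level s + 1 the cofactors of f and of Ĉ f each contain an extra q; hence the mixed error
  -- term needs no hypothesis, and only w δ remains modulo q.
  have h1 := newton_step f (q := q) (a := q ^ s) (w := w) (z := z) (δ := δ)
    (g := fun i => q * g i) (h := fun i => q * e i)
    (fun i => by rw [hg]; ring) hw (fun i => by rw [he]; ring) hδ
    (fun i j => ⟨q ^ s * δ i * g j, by ring⟩) i
  have h2 := h'.adj i
  simp only [pow_succ' q s] at h2
  obtain ⟨b, hb⟩ := h1
  obtain ⟨c, hc'⟩ := h2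
  rw [hc'] at hb
  have h3 : w * δ i = q * (c - e i - b) := (hq.pow (s + 2)) (by
    simp only
    linear_combination -hb)
  exact (hc (Nat.le_add_left 1 s)).symm.dvd_of_dvd_mul_left ⟨_, h3⟩

/-- The existence part of Newton's method. -/
theorem exists_newton_step {s : ℕ} {q w : P} {z : Fin n ⊕ Fin l → P} {g h : Fin l → P}
    (hg : ∀ i, MvPolynomial.aeval z (f i) = q ^ (s + 1) * g i)
    (hw : MvPolynomial.aeval z (jacDet f) = q * w) (hc : IsCoprime w q)
    (hh : ∀ i, MvPolynomial.aeval z (newtonPoly f i) = q ^ (s + 2) * h i)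
    (h1 : ∀ i j, q ∣ q ^ s * h i * h j) (h2 : ∀ i j, q ∣ q ^ s * h i * g j) :
    ∃ δ : Fin l → P, (∀ i, h i ∣ δ i) ∧ ∀ i, q ^ (s + 3) ∣
      MvPolynomial.aeval (z + Sum.elim (0 : Fin n → P) (fun j => q ^ (s + 1) * δ j)) (newtonPoly f i) := by
  obtain ⟨a, b, hab⟩ := hc
  -- Since a inverts w modulo q, δ = -a h solves h + w δ ≡ 0. That δ is a multiple of h is kept in
  -- the conclusion: it ensures later that a lift already correct over a quotient stays correct
  -- there.
  refine ⟨fun i => h i * -a, fun i => dvd_mul_right _ _, fun i => ?_⟩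
  obtain ⟨c, hc'⟩ := newton_step f (q := q) (a := q ^ s) (w := w) (z := z) (δ := fun i => h i * -a)
    (g := g) (h := h) (fun i => by rw [hg]; ring) hw (fun i => by rw [hh]; ring)
    (fun i j => by
      obtain ⟨c, hc⟩ := h1 i j
      exact ⟨c * a ^ 2, by linear_combination a ^ 2 * hc⟩)
    (fun i j => by
      obtain ⟨c, hc⟩ := h2 i j
      exact ⟨-c * a, by linear_combination -a * hc⟩) i
  refine ⟨c + h i * b, ?_⟩
  simp only [pow_succ' q s]
  linear_combination hc' + q ^ (s + 2) * h i * (-hab)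

end Newton

/-! ### Remainders and digits in base q -/

section Digits

variable {R S : Type*} [CommRing R] [CommRing S]

theorem IsMonicDeg.monic {R : Type u} [CommRing R] {N : ℕ} {q : R[X]} (h : IsMonicDeg N q) :
    q.Monic :=
  Polynomial.monic_of_natDegree_le_of_coeff_eq_one N h.1 h.2

/-- The polynomial `∑ c_j t ^ j`. -/
noncomputable def ofCoeffs {m : ℕ} (c : Fin m → R) : R[X] :=
  ∑ j, Polynomial.monomial j.1 (c j)

theorem coeff_ofCoeffs {m : ℕ} (c : Fin m → R) (j : Fin m) : (ofCoeffs c).coeff j = c j := by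
  rw [ofCoeffs, Polynomial.finsetSum_coeff, Finset.sum_eq_single j]
  · simp
  · intro b _ hb
    rw [Polynomial.coeff_monomial, if_neg (fun h => hb (Fin.ext h))]
  · simp

theorem coeff_ofCoeffs_of_le {m : ℕ} (c : Fin m → R) {d : ℕ} (h : m ≤ d) :
    (ofCoeffs c).coeff d = 0 := by
  rw [ofCoeffs, Polynomial.finsetSum_coeff]
  refine Finset.sum_eq_zero fun b _ => ?_
  rw [Polynomial.coeff_monomial, if_neg (by have := b.2; omega)]

theorem ofCoeffs_map (φ : R →+* S) {m : ℕ} (c : Fin m → R) :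
    (ofCoeffs c).map φ = ofCoeffs fun j => φ (c j) := by
  simp [ofCoeffs, Polynomial.map_sum]

theorem ofCoeffs_coeff {m : ℕ} {g : R[X]} (hg : ∀ d, m ≤ d → g.coeff d = 0) :
    ofCoeffs (fun j : Fin m => g.coeff j) = g := by
  ext d
  rcases lt_or_ge d m with h | h
  · exact coeff_ofCoeffs _ ⟨d, h⟩
  · rw [coeff_ofCoeffs_of_le _ h, hg d h]

theorem IsMonicDeg.pow {R : Type u} [CommRing R] {N : ℕ} {q : R[X]} (h : IsMonicDeg N q)
    (r : ℕ) : IsMonicDeg (r * N) (q ^ r) := by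
  refine ⟨Polynomial.natDegree_pow_le_of_le r h.1, ?_⟩
  have := Polynomial.coeff_pow_of_natDegree_le (m := r) h.1
  rw [this, h.2, one_pow]

theorem IsMonicDeg.coeff_modByMonic {R : Type u} [CommRing R] {N : ℕ} {q : R[X]}
    (h : IsMonicDeg N q) (g : R[X]) {d : ℕ} (hd : N ≤ d) : (g %ₘ q).coeff d = 0 := by
  nontriviality R
  refine Polynomial.coeff_eq_zero_of_degree_lt ((Polynomial.degree_modByMonic_lt g h.monic).trans_le ?_)
  exact Polynomial.degree_le_of_natDegree_le (h.1.trans hd)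

theorem IsMonicDeg.modByMonic_ofCoeffs {R : Type u} [CommRing R] {N : ℕ} {q : R[X]}
    (h : IsMonicDeg N q) (c : Fin N → R) : ofCoeffs c %ₘ q = ofCoeffs c := by
  nontriviality R
  rw [Polynomial.modByMonic_eq_self_iff h.monic, Polynomial.degree_eq_natDegree h.monic.ne_zero]
  have hN : q.natDegree = N := le_antisymm h.1 (Polynomial.le_natDegree_of_ne_zero (by
    rw [h.2]; exact one_ne_zero))
  rw [hN, Polynomial.degree_lt_iff_coeff_zero]
  exact fun d hd => coeff_ofCoeffs_of_le c hd

/-- The `r`-th digit of a polynomial in base `q`. -/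
noncomputable def digit (q : R[X]) (r : ℕ) (g : R[X]) : R[X] := (g /ₘ q ^ r) %ₘ q

theorem digit_add_mul {q : R[X]} (hq : q.Monic) (r : ℕ) (g e : R[X]) :
    digit q r (g %ₘ q ^ r + q ^ r * e) = e %ₘ q := by
  nontriviality R
  rw [digit, (Polynomial.div_modByMonic_unique e (g %ₘ q ^ r) (hq.pow r)
    ⟨rfl, Polynomial.degree_modByMonic_lt g (hq.pow r)⟩).1]

theorem digit_congr {q : R[X]} (hq : q.Monic) {r : ℕ} {g g' : R[X]} (h : q ^ (r + 1) ∣ g' - g) :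
    digit q r g' = digit q r g := by
  obtain ⟨c, hc⟩ := h
  have h1 : g' = g %ₘ q ^ r + q ^ r * (g /ₘ q ^ r + q * c) := by
    have := Polynomial.modByMonic_add_div g (q ^ r)
    linear_combination hc - this
  rw [h1, digit_add_mul hq, digit, Polynomial.add_modByMonic]
  rw [(Polynomial.modByMonic_eq_zero_iff_dvd hq).2 (dvd_mul_right q c), add_zero]

/-- Congruence modulo q ^ r makes the remainders equal, so the difference is q ^ r times the
difference of the quotients, which the digits control modulo q. -/
theorem dvd_sub_of_digit {q : R[X]} (hq : q.Monic) {r : ℕ} {g g' : R[X]} (h : q ^ r ∣ g' - g)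
    (hd : digit q r g' = digit q r g) : q ^ (r + 1) ∣ g' - g := by
  have h1 := Polynomial.modByMonic_add_div g (q ^ r)
  have h2 := Polynomial.modByMonic_add_div g' (q ^ r)
  have h3 : g' %ₘ q ^ r = g %ₘ q ^ r := Polynomial.modByMonic_eq_of_dvd_sub (hq.pow r) h
  have h4 : q ∣ g' /ₘ q ^ r - g /ₘ q ^ r := by
    rw [← Polynomial.modByMonic_eq_zero_iff_dvd hq, Polynomial.sub_modByMonic, sub_eq_zero]
    exact hd
  obtain ⟨c, hc⟩ := h4
  refine ⟨c, ?_⟩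
  rw [h3] at h2
  linear_combination h1 - h2 + q ^ r * hc

/-- Division by a monic polynomial commutes with base change; this makes the digit coordinates
functorial. -/
theorem digit_map {q : R[X]} (hq : q.Monic) (φ : R →+* S) (r : ℕ) (g : R[X]) :
    (digit q r g).map φ = digit (q.map φ) r (g.map φ) := by
  rw [digit, Polynomial.map_modByMonic _ hq, Polynomial.map_divByMonic _ (hq.pow r),
    Polynomial.map_pow, digit]

end Digits

/-! ### Points of Z_r in terms of polynomial representatives -/

section Points

variable {k : Type u} [Field k] {n l : ℕ} {R S : Type u} [CommRing R] [Algebra k R]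
  [CommRing S] [Algebra k S]

theorem cls_eq_cls {q : R[X]} {r : ℕ} {g g' : R[X]} :
    cls q r g = cls q r g' ↔ q ^ r ∣ g - g' := by
  rw [cls, Ideal.Quotient.eq, Ideal.mem_span_singleton]

theorem cls_eq_zero {q : R[X]} {r : ℕ} {g : R[X]} : cls q r g = 0 ↔ q ^ r ∣ g := by
  rw [← map_zero (cls q r), cls_eq_cls, sub_zero]

theorem aeval_cls (q : R[X]) (r : ℕ) (z : Fin n ⊕ Fin l → R[X])
    (F : MvPolynomial (Fin n ⊕ Fin l) k) :
    MvPolynomial.aeval (fun i => cls q r (z i)) F = cls q r (MvPolynomial.aeval z F) :=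
  aeval_map (Ideal.Quotient.mkₐ k _ : R[X] →ₐ[k] Trunc q r) z F

theorem isUnit_cls {q g : R[X]} {r : ℕ} (h : IsCoprime g (q ^ r)) : IsUnit (cls q r g) := by
  obtain ⟨a, b, hab⟩ := h
  refine IsUnit.of_mul_eq_one (cls q r a) ?_
  rw [← map_mul, ← map_one (cls q r), cls_eq_cls]
  exact ⟨-b, by linear_combination hab⟩

theorem isCoprime_of_isUnit_cls {q g : R[X]} {r : ℕ} (h : IsUnit (cls q r g)) :
    IsCoprime g (q ^ r) := by
  obtain ⟨a, ha⟩ := h.exists_right_inv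
  obtain ⟨a, rfl⟩ := cls_surjective q r a
  rw [← map_mul, ← map_one (cls q r), cls_eq_cls] at ha
  obtain ⟨c, hc⟩ := ha
  exact ⟨a, -c, by linear_combination hc⟩

variable {f : Fin l → MvPolynomial (Fin n ⊕ Fin l) k} {N : ℕ}

theorem glue_cls {s : ℕ} (q : R[X]) (z : Fin n ⊕ Fin l → R[X]) :
    glue (k := k) (fun i => cls q (s + 2) (z (Sum.inl i)))
      (fun i => cls q (s + 1) (z (Sum.inr i))) = fun i => cls q (s + 1) (z i) := by
  funext i
  rcases i with i | i <;> rfl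

theorem elim_cls {s : ℕ} (q : R[X]) (z : Fin n ⊕ Fin l → R[X]) :
    Sum.elim (fun i => cls q s (z (Sum.inl i))) (fun i => cls q s (z (Sum.inr i))) =
      fun i => cls q s (z i) := by
  funext i
  rcases i with i | i <;> rfl

/-- The point with given representatives. -/
noncomputable def NewtonPoint.mk' {s : ℕ} {q : R[X]} (hq : IsMonicDeg N q)
    (z : Fin n ⊕ Fin l → R[X]) (h : IsNewton f s q z) : NewtonPoint f N s R where
  q := q
  monic := hq
  x i := cls q (s + 2) (z (Sum.inl i))
  y i := cls q (s + 1) (z (Sum.inr i))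
  eqn i := by
    rw [glue_cls, aeval_cls, cls_eq_zero]
    exact h.eqn i
  det_zero := by
    obtain ⟨w, hw, -⟩ := h.det
    rw [glue_cls, aeval_cls, red_cls, cls_eq_zero, hw, pow_one]
    exact dvd_mul_right _ _
  adj := by
    refine ⟨fun i => cls q (s + 2) (z (Sum.inr i)), fun i => rfl, ?_⟩
    funext i
    rw [elim_cls, ← aeval_newtonPoly, aeval_cls]
    exact cls_eq_zero.2 (h.adj i)
  unit hs := by
    obtain ⟨w, hw, hc⟩ := h.det
    refine ⟨cls q (s + 1) w, ?_, ?_⟩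
    · rw [glue_cls, aeval_cls, hw, map_mul]
    · rw [red_cls]
      exact isUnit_cls (hc (by omega)).pow_right

/-- The lift of y provided by `adj` gives one good representative, and `IsNewton.congr` passes from
it to any other. In particular the choice of the lift of y is irrelevant. -/
theorem NewtonPoint.isNewton {s : ℕ} (p : NewtonPoint f N s R) {z : Fin n ⊕ Fin l → R[X]}
    (hx : ∀ i, cls p.q (s + 2) (z (Sum.inl i)) = p.x i)
    (hy : ∀ i, cls p.q (s + 1) (z (Sum.inr i)) = p.y i) : IsNewton f s p.q z := by
  obtain ⟨q, hq, x, y, eqn, det_zero, ⟨y', hy', adj⟩, unit⟩ := p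
  dsimp only at hx hy ⊢
  obtain rfl : (fun i => cls q (s + 2) (z (Sum.inl i))) = x := funext hx
  choose y'' hy'' using fun i => cls_surjective q (s + 2) (y' i)
  obtain rfl : (fun i => cls q (s + 2) (y'' i)) = y' := funext hy''
  obtain rfl : (fun i => cls q (s + 1) (y'' i)) = y := funext hy'
  set z' : Fin n ⊕ Fin l → R[X] := Sum.elim (fun i => z (Sum.inl i)) y'' with hz'
  have h1 : IsNewton f s q z' := by
    have e1 := glue_cls (k := k) (s := s) q z'
    have e2 := elim_cls (s := s + 2) q z'
    simp only [hz', Sum.elim_inl, Sum.elim_inr] at e1 e2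
    rw [← hz'] at e1 e2
    refine ⟨fun i => ?_, ?_, fun i => ?_⟩
    · have := eqn i
      rwa [e1, aeval_cls, cls_eq_zero] at this
    · rw [e1, aeval_cls, red_cls, cls_eq_zero, pow_one] at det_zero
      obtain ⟨w, hw⟩ := det_zero
      refine ⟨w, hw, fun hs => ?_⟩
      obtain ⟨v, hv, hu⟩ := unit (by omega)
      obtain ⟨v, rfl⟩ := cls_surjective q (s + 1) v
      rw [e1, aeval_cls, ← map_mul, cls_eq_cls, hw] at hv
      rw [red_cls] at hu
      have h2 := (IsCoprime.pow_right_iff (by omega)).1 (isCoprime_of_isUnit_cls hu)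
      obtain ⟨c, hc⟩ := hv
      obtain ⟨m, rfl⟩ := Nat.exists_eq_add_of_le' hs
      -- Cancelling q in Q leaves w determined modulo q ^ s. As s ≥ 1, coprimality with q passes
      -- from v to w.
      have h3 : w = v + q * (q ^ m * c) := hq.monic.isRegular.left (by
        simp only
        linear_combination hc)
      rw [h3]
      exact h2.add_mul_left_left _
    · have := congrFun adj i
      rw [e2, ← aeval_newtonPoly, aeval_cls] at this
      exact cls_eq_zero.1 this
  refine h1.congr (fun i => by simp [hz']) fun i => ?_
  rw [← cls_eq_cls]
  exact hy i

theorem NewtonPoint.eq_mk' {s : ℕ} (p : NewtonPoint f N s R) {z : Fin n ⊕ Fin l → R[X]}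
    (hx : ∀ i, cls p.q (s + 2) (z (Sum.inl i)) = p.x i)
    (hy : ∀ i, cls p.q (s + 1) (z (Sum.inr i)) = p.y i) :
    p = NewtonPoint.mk' p.monic z (p.isNewton hx hy) :=
  NewtonPoint.ext' rfl (fun i => ⟨_, hx i, rfl⟩) (fun i => ⟨_, hy i, rfl⟩)

theorem NewtonPoint.exists_eq_mk' {s : ℕ} (p : NewtonPoint f N s R) :
    ∃ (q : R[X]) (hq : IsMonicDeg N q) (z : Fin n ⊕ Fin l → R[X]) (h : IsNewton f s q z),
      p = NewtonPoint.mk' hq z h := by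
  choose x hx using fun i => cls_surjective p.q (s + 2) (p.x i)
  choose y hy using fun i => cls_surjective p.q (s + 1) (p.y i)
  exact ⟨_, _, Sum.elim x y, p.isNewton hx hy, p.eq_mk' hx hy⟩

theorem NewtonPoint.mk'_eq_mk' {s : ℕ} {q : R[X]} {hq hq' : IsMonicDeg N q}
    {z z' : Fin n ⊕ Fin l → R[X]} {h : IsNewton f s q z} {h' : IsNewton f s q z'} :
    NewtonPoint.mk' hq z h = NewtonPoint.mk' hq' z' h' ↔
      (∀ i, q ^ (s + 2) ∣ z (Sum.inl i) - z' (Sum.inl i)) ∧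
      ∀ i, q ^ (s + 1) ∣ z (Sum.inr i) - z' (Sum.inr i) := by
  constructor
  · intro e
    injection e with _ e1 e2
    exact ⟨fun i => cls_eq_cls.1 (congrFun e1 i), fun i => cls_eq_cls.1 (congrFun e2 i)⟩
  · rintro ⟨h1, h2⟩
    exact NewtonPoint.ext' rfl (fun i => ⟨_, rfl, cls_eq_cls.2 (h1 i)⟩)
      (fun i => ⟨_, rfl, cls_eq_cls.2 (h2 i)⟩)

theorem NewtonPoint.trunc_mk' {s : ℕ} {q : R[X]} {hq : IsMonicDeg N q}
    {z : Fin n ⊕ Fin l → R[X]} {h : IsNewton f (s + 1) q z} :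
    (NewtonPoint.mk' hq z h).trunc = NewtonPoint.mk' hq z h.of_succ := rfl

theorem IsNewton.polynomialMap {s : ℕ} {q : R[X]} {z : Fin n ⊕ Fin l → R[X]}
    (h : IsNewton f s q z) (φ : R →ₐ[k] S) :
    IsNewton f s (q.map (φ : R →+* S)) (fun i => (z i).map (φ : R →+* S)) :=
  h.map (Polynomial.mapAlgHom φ)

theorem NewtonPoint.map_mk' {s : ℕ} {q : R[X]} {hq : IsMonicDeg N q}
    {z : Fin n ⊕ Fin l → R[X]} {h : IsNewton f s q z} (φ : R →ₐ[k] S) :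
    (NewtonPoint.mk' hq z h).map φ = NewtonPoint.mk' (hq.map φ) _ (h.polynomialMap φ) := rfl

/-- The coefficients of the last digits of the coordinates `x`. -/
noncomputable def NewtonPoint.digits {s : ℕ} (p : NewtonPoint f N (s + 1) R) :
    Fin n × Fin N → R :=
  fun i => (digit p.q (s + 2) (Function.surjInv (cls_surjective p.q (s + 3)) (p.x i.1))).coeff i.2

/-- The representative chosen in `digits` does not matter, since the digit of order s + 2 depends
only on the class modulo q ^ (s + 3). -/
theorem NewtonPoint.digits_mk' {s : ℕ} {q : R[X]} {hq : IsMonicDeg N q}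
    {z : Fin n ⊕ Fin l → R[X]} {h : IsNewton f (s + 1) q z} :
    (NewtonPoint.mk' hq z h).digits =
      fun i => (digit q (s + 2) (z (Sum.inl i.1))).coeff i.2 := by
  funext i
  have h1 := Function.surjInv_eq (cls_surjective q (s + 3)) (cls q (s + 3) (z (Sum.inl i.1)))
  exact congrArg (fun g => g.coeff i.2.1) (digit_congr hq.monic (cls_eq_cls.1 h1))

theorem NewtonPoint.digits_map {s : ℕ} (p : NewtonPoint f N (s + 1) R) (φ : R →ₐ[k] S) :
    (p.map φ).digits = fun i => φ (p.digits i) := by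
  obtain ⟨q, hq, z, h, rfl⟩ := p.exists_eq_mk'
  rw [map_mk', digits_mk', digits_mk']
  funext i
  simp only
  rw [← digit_map hq.monic, Polynomial.coeff_map]
  rfl

theorem digit_ext {q : R[X]} (hq : IsMonicDeg N q) {r : ℕ} {g g' : R[X]}
    (h : ∀ j : Fin N, (digit q r g).coeff j = (digit q r g').coeff j) :
    digit q r g = digit q r g' := by
  ext d
  rcases lt_or_ge d N with hd | hd
  · exact h ⟨d, hd⟩
  · rw [digit, digit, hq.coeff_modByMonic _ hd, hq.coeff_modByMonic _ hd]

end Points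

/-! ### Divisibility and coprimality along square-zero extensions -/

section Thickening

variable {R S : Type*} [CommRing R] [CommRing S] (φ : R →+* S)

theorem mul_eq_zero_of_map_eq_zero (h : ∀ a b, φ a = 0 → φ b = 0 → a * b = 0) {a b : R[X]}
    (ha : a.map φ = 0) (hb : b.map φ = 0) : a * b = 0 := by
  have h' : ∀ {g : R[X]}, g.map φ = 0 → ∀ d, φ (g.coeff d) = 0 := fun hg d => by
    rw [← Polynomial.coeff_map, hg, Polynomial.coeff_zero]
  ext d
  rw [Polynomial.coeff_mul, Polynomial.coeff_zero]
  exact Finset.sum_eq_zero fun x _ => h _ _ (h' ha _) (h' hb _)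

theorem exists_eq_mul_add_of_map_dvd (hφ : Function.Surjective φ) {q g : R[X]}
    (h : q.map φ ∣ g.map φ) : ∃ a b : R[X], g = q * a + b ∧ b.map φ = 0 := by
  obtain ⟨c, hc⟩ := h
  obtain ⟨a, rfl⟩ := Polynomial.map_surjective φ hφ c
  exact ⟨a, g - q * a, by ring, by rw [Polynomial.map_sub, hc, Polynomial.map_mul, sub_self]⟩

/-- Each factor is a multiple of q plus a polynomial with coefficients in the kernel, and two
polynomials of the latter kind have product zero. This replaces the missing power of q in Newton's
method for r = 2. -/
theorem dvd_mul_of_map_dvd (hφ : Function.Surjective φ)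
    (h : ∀ a b, φ a = 0 → φ b = 0 → a * b = 0) {q g g' : R[X]}
    (h1 : q.map φ ∣ g.map φ) (h2 : q.map φ ∣ g'.map φ) : q ∣ g * g' := by
  obtain ⟨a, b, rfl, hb⟩ := exists_eq_mul_add_of_map_dvd φ hφ h1
  obtain ⟨a', b', rfl, hb'⟩ := exists_eq_mul_add_of_map_dvd φ hφ h2
  have := mul_eq_zero_of_map_eq_zero φ h hb hb'
  exact ⟨a * (q * a' + b') + b * a', by linear_combination this⟩

/-- A lifted Bézout relation reads a g + b q = 1 + c with c² = 0; multiplication by 1 - c repairs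
it. -/
theorem isCoprime_of_map (hφ : Function.Surjective φ)
    (h : ∀ a b, φ a = 0 → φ b = 0 → a * b = 0) {g q : R[X]}
    (hc : IsCoprime (g.map φ) (q.map φ)) : IsCoprime g q := by
  obtain ⟨a, b, hab⟩ := hc
  obtain ⟨a, rfl⟩ := Polynomial.map_surjective φ hφ a
  obtain ⟨b, rfl⟩ := Polynomial.map_surjective φ hφ b
  set c := a * g + b * q - 1 with hc
  have hc0 : c.map φ = 0 := by
    simp [hc, hab]
  have := mul_eq_zero_of_map_eq_zero φ h hc0 hc0
  refine ⟨a * (1 - c), b * (1 - c), ?_⟩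
  rw [hc] at this ⊢
  linear_combination -this

end Thickening

/-! ### Lifting points from Z_r to Z_(r+1) -/

section Lifting

variable {k : Type u} [Field k] {n l : ℕ} {R S : Type u} [CommRing R] [Algebra k R]
  [CommRing S] [Algebra k S] {f : Fin l → MvPolynomial (Fin n ⊕ Fin l) k} {N : ℕ}

/-- Equal digits make the x-parts agree to the full order, so only a change of y by q ^ (s + 1) δ
remains and the uniqueness in Newton's method applies. It needs q ∣ q ^ s δ_i δ_j: this is clear if
s ≥ 1, and for s = 0 it follows from agreement over a square-zero quotient. -/
theorem NewtonPoint.eq_of_trunc_eq_of_digits_eq {s : ℕ} {p p' : NewtonPoint f N (s + 1) R}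
    (ht : p.trunc = p'.trunc) (hd : p.digits = p'.digits)
    (hs : 1 ≤ s ∨ ∃ (S : Type u) (_ : CommRing S) (_ : Algebra k S) (φ : R →ₐ[k] S),
      Function.Surjective φ ∧ (∀ a b, φ a = 0 → φ b = 0 → a * b = 0) ∧ p.map φ = p'.map φ) :
    p = p' := by
  obtain ⟨q, hm, z, h, rfl⟩ := p.exists_eq_mk'
  obtain ⟨q', hm', z', h', rfl⟩ := p'.exists_eq_mk'
  obtain rfl : q = q' := congrArg NewtonPoint.q ht
  rw [NewtonPoint.trunc_mk', NewtonPoint.trunc_mk', NewtonPoint.mk'_eq_mk'] at ht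
  obtain ⟨hx, hy⟩ := ht
  rw [NewtonPoint.digits_mk', NewtonPoint.digits_mk'] at hd
  have hx' : ∀ i, q ^ (s + 3) ∣ z (Sum.inl i) - z' (Sum.inl i) := by
    intro i
    exact dvd_sub_of_digit hm.monic (hx i) (digit_ext hm fun j => congrFun hd (i, j))
  choose δ hδ using hy
  have e : z' + Sum.elim (fun i => z (Sum.inl i) - z' (Sum.inl i)) (0 : Fin l → R[X]) +
      Sum.elim (0 : Fin n → R[X]) (fun j => q ^ (s + 1) * δ j) = z := by
    funext j
    rcases j with j | j
    · simp
    · simp [← hδ]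
  have h1 : IsNewton f (s + 1) q
      (z' + Sum.elim (fun i => z (Sum.inl i) - z' (Sum.inl i)) (0 : Fin l → R[X])) :=
    h'.add hx' (fun i => by simp)
  have h2 : ∀ i, q ∣ δ i := by
    refine fun i => IsNewton.dvd_of_add hm.monic.isRegular.left h1 (e.symm ▸ h) ?_ i
    rcases hs with hs | ⟨S, _, _, φ, hφ, hker, hmap⟩
    · obtain ⟨m, rfl⟩ := Nat.exists_eq_add_of_le' hs
      exact fun i j => ⟨q ^ m * δ i * δ j, by ring⟩
    · rw [NewtonPoint.map_mk', NewtonPoint.map_mk', NewtonPoint.mk'_eq_mk'] at hmap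
      have h3 : ∀ i, q.map (φ : R →+* S) ∣ (δ i).map (φ : R →+* S) := by
        intro i
        have := hmap.2 i
        rw [← Polynomial.map_sub, hδ, Polynomial.map_mul, Polynomial.map_pow,
          pow_succ _ (s + 1)] at this
        obtain ⟨c, hc⟩ := this
        refine ⟨c, ((hm.map φ).monic.pow (s + 1)).isRegular.left ?_⟩
        simp only
        rw [hc, mul_assoc]
      intro i j
      rw [mul_assoc]
      exact (dvd_mul_of_map_dvd (φ : R →+* S) hφ hker (h3 i) (h3 j)).mul_left _
  rw [NewtonPoint.mk'_eq_mk']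
  refine ⟨hx', fun i => ?_⟩
  rw [hδ, pow_succ _ (s + 1)]
  exact mul_dvd_mul_left _ (h2 i)

/-- Representatives of a point with prescribed last digits of `x`. -/
theorem NewtonPoint.exists_eq_mk'_digits {s : ℕ} (p : NewtonPoint f N s R)
    (c : Fin n × Fin N → R) :
    ∃ (q : R[X]) (hq : IsMonicDeg N q) (z : Fin n ⊕ Fin l → R[X]) (h : IsNewton f s q z),
      p = NewtonPoint.mk' hq z h ∧ ∀ i, (digit q (s + 2) (z (Sum.inl i.1))).coeff i.2 = c i := by
  obtain ⟨q, hm, z, h, rfl⟩ := p.exists_eq_mk'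
  set z' : Fin n ⊕ Fin l → R[X] := Sum.elim
    (fun i => z (Sum.inl i) %ₘ q ^ (s + 2) + q ^ (s + 2) * ofCoeffs fun j => c (i, j))
    (fun i => z (Sum.inr i)) with hz'
  have hx : ∀ i, q ^ (s + 2) ∣ z' (Sum.inl i) - z (Sum.inl i) := by
    intro i
    have := Polynomial.modByMonic_add_div (z (Sum.inl i)) (q ^ (s + 2))
    refine ⟨(ofCoeffs fun j => c (i, j)) - z (Sum.inl i) /ₘ q ^ (s + 2), ?_⟩
    simp only [hz', Sum.elim_inl]
    linear_combination this
  have hy : ∀ i, q ^ (s + 1) ∣ z' (Sum.inr i) - z (Sum.inr i) := fun i => by simp [hz']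
  refine ⟨q, hm, z', h.congr hx hy, ?_, fun i => ?_⟩
  · rw [NewtonPoint.mk'_eq_mk']
    exact ⟨fun i => dvd_sub_comm.1 (hx i), fun i => dvd_sub_comm.1 (hy i)⟩
  · simp only [hz', Sum.elim_inl]
    rw [digit_add_mul hm.monic, hm.modByMonic_ofCoeffs, coeff_ofCoeffs]

/-- From level s + 1 ≥ 1 on, w is already coprime to q and the factor q ^ (s + 1) absorbs all error
terms, so a Newton step works over R itself, with no infinitesimal assumption. -/
theorem NewtonPoint.existsUnique_of_trunc_digits {s : ℕ} (p : NewtonPoint f N (s + 1) R)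
    (c : Fin n × Fin N → R) :
    ∃! p' : NewtonPoint f N (s + 2) R, p'.trunc = p ∧ p'.digits = c := by
  refine existsUnique_of_exists_of_unique ?_ fun p₁ p₂ h₁ h₂ =>
    NewtonPoint.eq_of_trunc_eq_of_digits_eq (h₁.1.trans h₂.1.symm) (h₁.2.trans h₂.2.symm)
      (Or.inl (Nat.le_add_left 1 s))
  obtain ⟨q, hm, z, h, rfl, hc⟩ := p.exists_eq_mk'_digits c
  choose g hg using h.eqn
  choose b hb using h.adj
  obtain ⟨w, hw, hcop⟩ := h.det
  obtain ⟨δ, -, hδ⟩ := exists_newton_step (s := s + 1) hg hw (hcop (Nat.le_add_left 1 s)) hb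
    (fun i j => ⟨q ^ s * b i * b j, by ring⟩) (fun i j => ⟨q ^ s * b i * g j, by ring⟩)
  obtain ⟨w', hw', hcop'⟩ := (h.add (d := Sum.elim (0 : Fin n → R[X])
    (fun j => q ^ (s + 1 + 1) * δ j)) (fun i => by simp) (fun i => by simp)).det
  refine ⟨NewtonPoint.mk' hm _ (IsNewton.of_adj hm.monic.isRegular.left hw'
    (hcop' (Nat.le_add_left 1 s)) hδ), ?_, ?_⟩
  · rw [NewtonPoint.trunc_mk', NewtonPoint.mk'_eq_mk']
    exact ⟨fun i => by simp, fun i => by simp⟩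
  · rw [NewtonPoint.digits_mk']
    funext i
    simpa using hc i

/-- A representative over R is first adjusted so that it reduces to the given point over S; the
obstruction to being a point of Z_3 is then divisible by q over S, and one Newton step removes it.
-/
theorem NewtonPoint.exists_lift_zero (φ : R →ₐ[k] S) (hφ : Function.Surjective φ)
    (hker : ∀ a b, φ a = 0 → φ b = 0 → a * b = 0) (p : NewtonPoint f N 0 R)
    (c : Fin n × Fin N → R) (p' : NewtonPoint f N 1 S) (ht : p'.trunc = p.map φ)
    (hd : p'.digits = fun i => φ (c i)) :
    ∃ P : NewtonPoint f N 1 R, P.trunc = p ∧ P.digits = c ∧ P.map φ = p' := by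
  obtain ⟨q, hm, z, h, rfl, hc⟩ := p.exists_eq_mk'_digits c
  obtain ⟨q', hm', z', h', rfl⟩ := p'.exists_eq_mk'
  obtain rfl : q' = q.map (φ : R →+* S) := congrArg NewtonPoint.q ht
  rw [NewtonPoint.trunc_mk', NewtonPoint.map_mk', NewtonPoint.mk'_eq_mk'] at ht
  obtain ⟨hx, hy⟩ := ht
  have hx' : ∀ i, (q.map (φ : R →+* S)) ^ 3 ∣
      z' (Sum.inl i) - (z (Sum.inl i)).map (φ : R →+* S) := by
    intro i
    refine dvd_sub_of_digit hm'.monic (hx i) (digit_ext hm' fun j => ?_)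
    rw [NewtonPoint.digits_mk'] at hd
    rw [← digit_map hm.monic, Polynomial.coeff_map]
    exact (congrFun hd (i, j)).trans (congrArg φ (hc (i, j)).symm)
  choose η' hη' using hy
  choose η hη using fun i => Polynomial.map_surjective (φ : R →+* S) hφ (η' i)
  -- Over S the representatives of y differ by a multiple of q. Lifting the cofactor makes the
  -- reduction of y equal to that of p' as a polynomial.
  set z₁ : Fin n ⊕ Fin l → R[X] := z + Sum.elim (0 : Fin n → R[X]) (fun j => q * η j) with hz₁
  have hz₁x : ∀ i, z₁ (Sum.inl i) = z (Sum.inl i) := fun i => by simp [hz₁]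
  have hz₁y : ∀ i, z₁ (Sum.inr i) = z (Sum.inr i) + q * η i := fun i => by simp [hz₁]
  have h1 : IsNewton f 0 q z₁ := h.add (fun i => by simp) (fun i => by simp)
  have h1' : IsNewton f 1 (q.map (φ : R →+* S)) (fun i => (z₁ i).map (φ : R →+* S)) := by
    refine h'.congr (fun i => ?_) (fun i => ?_)
    · rw [hz₁x]
      exact dvd_sub_comm.1 (hx' i)
    · have := hη' i
      simp only [hz₁y, Polynomial.map_add, Polynomial.map_mul, hη]
      refine ⟨0, ?_⟩
      linear_combination -this
  choose g hg using h1.eqn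
  choose b hb using h1.adj
  obtain ⟨w, hw, -⟩ := h1.det
  have hreg := hm'.monic.isRegular.left
  have haev : ∀ F : MvPolynomial (Fin n ⊕ Fin l) k,
      MvPolynomial.aeval (fun i => (z₁ i).map (φ : R →+* S)) F =
        (MvPolynomial.aeval z₁ F).map (φ : R →+* S) :=
    aeval_map (Polynomial.mapAlgHom φ) z₁
  have hg' : ∀ i, q.map (φ : R →+* S) ∣ (g i).map (φ : R →+* S) := by
    intro i
    obtain ⟨a, ha⟩ := h1'.eqn i
    rw [haev, hg, Polynomial.map_mul, Polynomial.map_pow] at ha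
    refine ⟨a, hreg ?_⟩
    simp only
    linear_combination ha
  have hb' : ∀ i, q.map (φ : R →+* S) ∣ (b i).map (φ : R →+* S) := by
    intro i
    obtain ⟨a, ha⟩ := h1'.adj i
    rw [haev, hb, Polynomial.map_mul, Polynomial.map_pow] at ha
    refine ⟨a, (hreg.pow 2) ?_⟩
    simp only
    linear_combination ha
  -- Points of Z_2 carry no invertibility condition; it is imported from the point p' over S.
  have hcop : ∀ {z₂ : Fin n ⊕ Fin l → R[X]} {w₂ : R[X]},
      IsNewton f 1 (q.map (φ : R →+* S)) (fun i => (z₂ i).map (φ : R →+* S)) →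
      MvPolynomial.aeval z₂ (jacDet f) = q * w₂ → IsCoprime w₂ q := by
    intro z₂ w₂ h₂ hw₂
    refine isCoprime_of_map (φ : R →+* S) hφ hker ?_
    obtain ⟨v, hv, hvc⟩ := h₂.det
    have e : MvPolynomial.aeval (fun i => (z₂ i).map (φ : R →+* S)) (jacDet f) =
        (MvPolynomial.aeval z₂ (jacDet f)).map (φ : R →+* S) :=
      aeval_map (Polynomial.mapAlgHom φ) z₂ _
    rw [e, hw₂, Polynomial.map_mul] at hv
    rw [hreg hv]
    exact hvc le_rfl
  obtain ⟨δ, hδb, hδ⟩ := exists_newton_step (s := 0) hg hw (hcop h1' hw) hb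
    (fun i j => by
      rw [pow_zero, one_mul]
      exact dvd_mul_of_map_dvd (φ : R →+* S) hφ hker (hb' i) (hb' j))
    (fun i j => by
      rw [pow_zero, one_mul]
      exact dvd_mul_of_map_dvd (φ : R →+* S) hφ hker (hb' i) (hg' j))
  set z₂ : Fin n ⊕ Fin l → R[X] := z₁ + Sum.elim (0 : Fin n → R[X])
    (fun j => q ^ (0 + 1) * δ j) with hz₂
  have hz₂x : ∀ i, z₂ (Sum.inl i) = z (Sum.inl i) := fun i => by simp [hz₂, hz₁]
  have hz₂y : ∀ i, z₂ (Sum.inr i) = z₁ (Sum.inr i) + q * δ i := fun i => by simp [hz₂]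
  -- The correction δ is a multiple of b, which is divisible by q over S, so the Newton step does
  -- not change the point over S.
  have hyy : ∀ i, (q.map (φ : R →+* S)) ^ 2 ∣
      (z₂ (Sum.inr i)).map (φ : R →+* S) - (z₁ (Sum.inr i)).map (φ : R →+* S) := by
    intro i
    rw [hz₂y, Polynomial.map_add, add_sub_cancel_left, Polynomial.map_mul, pow_two]
    exact mul_dvd_mul_left _ ((hb' i).trans (Polynomial.map_dvd _ (hδb i)))
  have h2' : IsNewton f 1 (q.map (φ : R →+* S)) (fun i => (z₂ i).map (φ : R →+* S)) :=
    h1'.congr (fun i => by simp [hz₂x, hz₁x]) hyy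
  have h2 : IsNewton f 0 q z₂ := h1.add (fun i => by simp) (fun i => by simp)
  obtain ⟨w₂, hw₂, -⟩ := h2.det
  refine ⟨NewtonPoint.mk' hm z₂ (IsNewton.of_adj hm.monic.isRegular.left hw₂
    (hcop h2' hw₂) hδ), ?_, ?_, ?_⟩
  · rw [NewtonPoint.trunc_mk', NewtonPoint.mk'_eq_mk']
    refine ⟨fun i => by simp [hz₂x], fun i => ⟨η i + δ i, ?_⟩⟩
    rw [hz₂y, hz₁y]
    ring
  · rw [NewtonPoint.digits_mk']
    funext i
    simp only [hz₂x]
    exact hc i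
  · rw [NewtonPoint.map_mk', NewtonPoint.mk'_eq_mk']
    refine ⟨fun i => ?_, fun i => ?_⟩
    · simp only [hz₂x]
      exact dvd_sub_comm.1 (hx' i)
    · have := hyy i
      have h3 := hη' i
      have h4 : (z₁ (Sum.inr i)).map (φ : R →+* S) = z' (Sum.inr i) := by
        rw [hz₁y, Polynomial.map_add, Polynomial.map_mul, hη]
        linear_combination -h3
      rwa [h4] at this

/-- The infinitesimal lifting property of `Z_(r+1)` over `Z_r × 𝔸^(n N)`. -/
theorem NewtonPoint.existsUnique_lift {s : ℕ} (φ : R →ₐ[k] S) (hφ : Function.Surjective φ)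
    (hker : ∀ a b, φ a = 0 → φ b = 0 → a * b = 0) (p : NewtonPoint f N s R)
    (c : Fin n × Fin N → R) (p' : NewtonPoint f N (s + 1) S) (ht : p'.trunc = p.map φ)
    (hd : p'.digits = fun i => φ (c i)) :
    ∃! P : NewtonPoint f N (s + 1) R, (P.trunc = p ∧ P.digits = c) ∧ P.map φ = p' := by
  refine existsUnique_of_exists_of_unique ?_ fun p₁ p₂ h₁ h₂ =>
    NewtonPoint.eq_of_trunc_eq_of_digits_eq (h₁.1.1.trans h₂.1.1.symm)
      (h₁.1.2.trans h₂.1.2.symm)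
      (Or.inr ⟨S, _, _, φ, hφ, hker, h₁.2.trans h₂.2.symm⟩)
  rcases s with _ | s
  · obtain ⟨P, h1, h2, h3⟩ := NewtonPoint.exists_lift_zero φ hφ hker p c p' ht hd
    exact ⟨P, ⟨h1, h2⟩, h3⟩
  · obtain ⟨P, ⟨h1, h2⟩, -⟩ := p.existsUnique_of_trunc_digits c
    refine ⟨P, ⟨h1, h2⟩, NewtonPoint.eq_of_trunc_eq_of_digits_eq ?_ ?_
      (Or.inl (Nat.le_add_left 1 s))⟩
    · rw [ht, ← h1]
      exact (ConcreteCategory.congr_hom ((newtonTrunc f N (s + 1)).naturality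
        (CommAlgCat.ofHom φ)) P)
    · rw [NewtonPoint.digits_map, h2, hd]

end Lifting

/-! ### Arcs as limits of points of the Z_r, and their digits -/

section Arcs

variable {k : Type u} [Field k] {n l : ℕ} {R S : Type u} [CommRing R] [Algebra k R]
  [CommRing S] [Algebra k S] {f : Fin l → MvPolynomial (Fin n ⊕ Fin l) k} {N : ℕ}

theorem ArcPoint.trunc_trunc (P : ArcPoint f N R) (s : ℕ) : (P.trunc (s + 1)).trunc = P.trunc s := by
  refine NewtonPoint.ext' rfl (fun i => ?_) (fun i => ?_)
  · obtain ⟨g, hg⟩ := cls_surjective P.q (s + 2) (P.z (s + 2) (Sum.inl i))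
    exact ⟨g, hg.trans (P.compat (s + 2) (Sum.inl i)).symm, hg⟩
  · obtain ⟨g, hg⟩ := cls_surjective P.q (s + 1) (P.z (s + 1) (Sum.inr i))
    refine ⟨g, hg.trans ?_, hg.trans (P.compat (s + 1) (Sum.inr i)).symm⟩
    exact ((red_red P.q _ _ _).trans (P.red_z _ _)).symm

theorem ArcPoint.eq_of_trunc_eq {P P' : ArcPoint f N R} (h : ∀ s, P.trunc s = P'.trunc s) :
    P = P' := by
  obtain ⟨q, hq, z, mem, compat, pre⟩ := P
  obtain ⟨q', hq', z', mem', compat', pre'⟩ := P'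
  obtain rfl : q = q' := congrArg NewtonPoint.q (h 0)
  have hz := @ArcPoint.red_z (p := ⟨q, hq, z, mem, compat, pre⟩)
  have hz' := @ArcPoint.red_z (p := ⟨q, hq', z', mem', compat', pre'⟩)
  dsimp only at hz hz'
  obtain rfl : z = z' := by
    funext r i
    have h1 := h r
    injection h1 with _ hx hy
    rcases i with i | i
    · rw [← hz (Nat.le_add_right r 2), ← hz' (Nat.le_add_right r 2)]
      exact congrArg (red k q (Nat.le_add_right r 2)) (congrFun hx i)
    · have h2 := congrArg (red k q (Nat.le_succ r)) (congrFun hy i)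
      rwa [red_red, red_red, hz, hz'] at h2
  rfl

/-- Truncation keeps q, so a single q serves all levels and all congruences live in the same R[t].
-/
theorem NewtonPoint.exists_common {p : ∀ s, NewtonPoint f N s R}
    (hp : ∀ s, (p (s + 1)).trunc = p s) :
    ∃ (q : R[X]) (hq : IsMonicDeg N q), ∀ s, ∃ (z : Fin n ⊕ Fin l → R[X]) (h : IsNewton f s q z),
      p s = NewtonPoint.mk' hq z h := by
  obtain ⟨q, hq, z, h, e⟩ := (p 0).exists_eq_mk'
  refine ⟨q, hq, fun s => ?_⟩
  induction s with
  | zero => exact ⟨z, h, e⟩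
  | succ s ih =>
    obtain ⟨z₁, h₁, e₁⟩ := ih
    obtain ⟨q', hq', z₂, h₂, e₂⟩ := (p (s + 1)).exists_eq_mk'
    have := hp s
    rw [e₁, e₂] at this
    obtain rfl : q' = q := congrArg NewtonPoint.q this
    exact ⟨z₂, h₂, e₂⟩

/-- An arc is the same as a compatible system of points of the `Z_r`. -/
theorem ArcPoint.existsUnique_of_compatible {p : ∀ s, NewtonPoint f N s R}
    (hp : ∀ s, (p (s + 1)).trunc = p s) : ∃! P : ArcPoint f N R, ∀ s, P.trunc s = p s := by
  refine existsUnique_of_exists_of_unique ?_ fun P P' h h' =>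
    ArcPoint.eq_of_trunc_eq fun s => (h s).trans (h' s).symm
  obtain ⟨q, hq, H⟩ := NewtonPoint.exists_common hp
  choose z h e using H
  have hx : ∀ s i, q ^ (s + 2) ∣ z (s + 1) (Sum.inl i) - z s (Sum.inl i) := fun s => by
    have := hp s
    rw [e, e, NewtonPoint.trunc_mk', NewtonPoint.mk'_eq_mk'] at this
    exact this.1
  have hy : ∀ s i, q ^ (s + 1) ∣ z (s + 1) (Sum.inr i) - z s (Sum.inr i) := fun s => by
    have := hp s
    rw [e, e, NewtonPoint.trunc_mk', NewtonPoint.mk'_eq_mk'] at this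
    exact this.2
  have hz : ∀ s i, q ^ (s + 1) ∣ z (s + 1) i - z s i := by
    rintro s (i | i)
    · exact (pow_dvd_pow _ (Nat.le_succ _)).trans (hx s i)
    · exact hy s i
  -- The representative at level r is known modulo q ^ (r + 1) in all coordinates, which is more
  -- than its class modulo q ^ r requires.
  refine ⟨⟨q, hq, fun r i => cls q r (z r i), fun r i => ?_, fun r i => ?_, ?_⟩, fun s => ?_⟩
  · rw [aeval_cls, cls_eq_zero]
    exact (pow_dvd_pow _ (Nat.le_succ _)).trans ((h r).eqn i)
  · rw [red_cls, cls_eq_cls]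
    exact (pow_dvd_pow _ (Nat.le_succ _)).trans (hz r i)
  -- Q = q w with w a unit modulo q ^ 2, so Q and q generate the same ideal.
  · obtain ⟨w, hw, hc⟩ := (h 2).det
    rw [aeval_cls, hw, map_mul]
    exact Ideal.span_singleton_mul_right_unit (isUnit_cls (hc (by norm_num)).pow_right) _
  · rw [e]
    refine NewtonPoint.ext' rfl (fun i => ⟨z (s + 2) (Sum.inl i), rfl, ?_⟩)
      (fun i => ⟨z (s + 2) (Sum.inr i), rfl, ?_⟩)
    · refine cls_eq_cls.2 ?_
      have := dvd_add ((pow_dvd_pow q (Nat.le_succ _)).trans (hx (s + 1) i)) (hx s i)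
      rwa [sub_add_sub_cancel] at this
    · refine cls_eq_cls.2 ?_
      have := dvd_add ((pow_dvd_pow q (Nat.le_succ _)).trans (hy (s + 1) i)) (hy s i)
      rwa [sub_add_sub_cancel] at this

/-- The digits of all orders of an arc. -/
noncomputable def ArcPoint.digits (P : ArcPoint f N R) : Fin n × Fin N × ℕ → R :=
  fun i => (P.trunc (i.2.2 + 2)).digits (i.1, i.2.1)

theorem ArcPoint.digits_map (P : ArcPoint f N R) (φ : R →ₐ[k] S) :
    (P.map φ).digits = fun i => φ (P.digits i) := by
  funext i
  have h : (P.map φ).trunc (i.2.2 + 2) = (P.trunc (i.2.2 + 2)).map φ :=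
    ConcreteCategory.congr_hom ((arcTrunc f N (i.2.2 + 2)).naturality (CommAlgCat.ofHom φ)) P
  rw [ArcPoint.digits, h, NewtonPoint.digits_map]
  rfl

/-- Level 1 is Z_3, where x is known modulo q ^ 3; from there on each lift is determined by one more
digit, the m-th step using the digit of order m + 3. -/
theorem ArcPoint.existsUnique_of_digits (p : NewtonPoint f N 1 R) (c : Fin n × Fin N × ℕ → R) :
    ∃! P : ArcPoint f N R, P.trunc 1 = p ∧ P.digits = c := by
  have ext : ∀ (s : ℕ) (p p' : NewtonPoint f N (s + 2) R), p.trunc = p'.trunc →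
      p.digits = p'.digits → p = p' := fun s p p' h h' =>
    NewtonPoint.eq_of_trunc_eq_of_digits_eq h h' (Or.inl (Nat.le_add_left 1 s))
  refine existsUnique_of_exists_of_unique ?_ fun P P' h h' => ?_
  · choose F hF hF' using fun s (p : NewtonPoint f N (s + 1) R) (c : Fin n × Fin N → R) =>
      (p.existsUnique_of_trunc_digits c).exists
    let a : ∀ s, NewtonPoint f N (s + 1) R := fun s =>
      Nat.rec p (fun s b => F s b fun i => c (i.1, i.2, s)) s
    -- The recursion produces levels s + 1; truncating once gives a compatible family that also
    -- includes level 0.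
    let b : ∀ s, NewtonPoint f N s R := fun s => (a s).trunc
    have ha : ∀ s, (a (s + 1)).trunc = a s := fun s => hF s (a s) _
    have hb : ∀ s, (b (s + 1)).trunc = b s := fun s => by
      change (a (s + 1)).trunc.trunc = (a s).trunc
      rw [ha]
    obtain ⟨P, hP, -⟩ := ArcPoint.existsUnique_of_compatible hb
    refine ⟨P, (hP 1).trans (ha 0), ?_⟩
    funext i
    rw [ArcPoint.digits, hP]
    change (a (i.2.2 + 2)).trunc.digits _ = _
    rw [ha]
    exact congrFun (hF' _ _ _) (i.1, i.2.1)
  · have key : ∀ s, P.trunc (s + 1) = P'.trunc (s + 1) := by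
      intro s
      induction s with
      | zero => exact h.1.trans h'.1.symm
      | succ s ih =>
        refine ext s _ _ (by rw [P.trunc_trunc, P'.trunc_trunc, ih]) ?_
        funext i
        exact congrFun (h.2.trans h'.2.symm) (i.1, i.2, s)
    refine ArcPoint.eq_of_trunc_eq fun s => ?_
    rw [← P.trunc_trunc, ← P'.trunc_trunc, key]

end Arcs

/-! ### Functors defined by polynomial equations -/

section ClosedConditions

variable {k : Type u} [Field k] {ι : Type}

variable (k) in
/-- A condition on vectors with entries in `k`-algebras that is given by polynomial equations. -/
def IsClosedCondition (D : ∀ (R : Type u) [CommRing R] [Algebra k R], (ι → R) → Prop) : Prop :=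
  ∃ E : Set (MvPolynomial ι k), ∀ (R : Type u) [CommRing R] [Algebra k R] (c : ι → R),
    D R c ↔ ∀ e ∈ E, MvPolynomial.aeval c e = 0

theorem IsClosedCondition.forall {J : Type*}
    {D : J → ∀ (R : Type u) [CommRing R] [Algebra k R], (ι → R) → Prop}
    (h : ∀ j, IsClosedCondition k (D j)) : IsClosedCondition k fun R _ _ c => ∀ j, D j R c := by
  choose E hE using h
  refine ⟨⋃ j, E j, fun R _ _ c => ?_⟩
  simp only [hE, Set.mem_iUnion]
  exact ⟨fun h e ⟨j, hj⟩ => h j e hj, fun h j e he => h e ⟨j, he⟩⟩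

theorem IsClosedCondition.and {D D' : ∀ (R : Type u) [CommRing R] [Algebra k R], (ι → R) → Prop}
    (h : IsClosedCondition k D) (h' : IsClosedCondition k D') :
    IsClosedCondition k fun R _ _ c => D R c ∧ D' R c := by
  obtain ⟨E, hE⟩ := h
  obtain ⟨E', hE'⟩ := h'
  refine ⟨E ∪ E', fun R _ _ c => ?_⟩
  dsimp only
  rw [hE, hE']
  simp only [Set.mem_union, or_imp, forall_and]

/-- Divisibility by a monic polynomial means that the remainder vanishes, and remainders commute
with specialization. The equations are therefore the coefficients of the remainder for the universal
vector of variables. -/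
theorem isClosedCondition_dvd {q G : ∀ (R : Type u) [CommRing R] [Algebra k R], (ι → R) → R[X]}
    (hm : ∀ (R : Type u) [CommRing R] [Algebra k R] (c : ι → R), (q R c).Monic)
    (hq : ∀ (R S : Type u) [CommRing R] [Algebra k R] [CommRing S] [Algebra k S] (φ : R →ₐ[k] S)
      (c : ι → R), (q R c).map (φ : R →+* S) = q S (fun i => φ (c i)))
    (hG : ∀ (R S : Type u) [CommRing R] [Algebra k R] [CommRing S] [Algebra k S] (φ : R →ₐ[k] S)
      (c : ι → R), (G R c).map (φ : R →+* S) = G S (fun i => φ (c i))) :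
    IsClosedCondition k fun R _ _ c => q R c ∣ G R c := by
  refine ⟨Set.range fun d => (G _ (MvPolynomial.X (R := k)) %ₘ q _ MvPolynomial.X).coeff d,
    fun R _ _ c => ?_⟩
  have h1 : (G _ (MvPolynomial.X (R := k)) %ₘ q _ MvPolynomial.X).map
      (MvPolynomial.aeval c : MvPolynomial ι k →ₐ[k] R) = G R c %ₘ q R c := by
    rw [Polynomial.map_modByMonic _ (hm _ _)]
    erw [hq, hG]
    simp
  dsimp only
  rw [← Polynomial.modByMonic_eq_zero_iff_dvd (hm R c), ← h1, Set.forall_mem_range,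
    Polynomial.ext_iff]
  simp only [Polynomial.coeff_map, Polynomial.coeff_zero]
  rfl

/-- A functor whose points are the solutions of polynomial equations in finitely many variables
is represented by an algebra of finite type. -/
theorem exists_corepresentableBy [Finite ι] {F : CommAlgCat.{u} k ⥤ Type u}
    {D : ∀ (R : Type u) [CommRing R] [Algebra k R], (ι → R) → Prop} (hD : IsClosedCondition k D)
    (Φ : ∀ (R : CommAlgCat.{u} k) (c : ι → R), D R c → F.obj R)
    (hinj : ∀ (R : CommAlgCat.{u} k) (c c' : ι → R) (h : D R c) (h' : D R c'),
      Φ R c h = Φ R c' h' → c = c')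
    (hsurj : ∀ (R : CommAlgCat.{u} k) (p : F.obj R), ∃ c h, Φ R c h = p)
    (hmap : ∀ (R S : CommAlgCat.{u} k) (φ : R ⟶ S) (c : ι → R) (h : D R c)
      (h' : D S fun i => φ (c i)), F.map φ (Φ R c h) = Φ S (fun i => φ (c i)) h') :
    ∃ (A : Type u) (_ : CommRing A) (_ : Algebra k A), Algebra.FiniteType k A ∧
      Nonempty (F.CorepresentableBy (CommAlgCat.of k A)) := by
  obtain ⟨E, hE⟩ := hD
  let A := MvPolynomial ι k ⧸ Ideal.span E
  have hφ : ∀ (Y : CommAlgCat.{u} k) (φ : CommAlgCat.of k A ⟶ Y),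
      (φ.hom.comp (Ideal.Quotient.mkₐ k (Ideal.span E))) =
        MvPolynomial.aeval fun i => φ (Ideal.Quotient.mk (Ideal.span E) (MvPolynomial.X i)) := by
    intro Y φ
    ext i
    simp
    rfl
  have hgood : ∀ (Y : CommAlgCat.{u} k) (φ : CommAlgCat.of k A ⟶ Y),
      D Y fun i => φ (Ideal.Quotient.mk (Ideal.span E) (MvPolynomial.X i)) := by
    intro Y φ
    rw [hE]
    intro e he
    rw [← hφ]
    have : Ideal.Quotient.mk (Ideal.span E) e = 0 :=
      Ideal.Quotient.eq_zero_iff_mem.2 (Ideal.subset_span he)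
    exact (congrArg φ.hom this).trans (map_zero _)
  refine ⟨A, inferInstance, inferInstance, inferInstance, ⟨⟨fun {Y} => Equiv.ofBijective
    (fun φ => Φ Y _ (hgood Y φ)) ⟨fun φ ψ h => ?_, fun p => ?_⟩, fun {Y Y'} g φ => ?_⟩⟩⟩
  · have h1 := hinj _ _ _ _ _ h
    have h2 : φ.hom.comp (Ideal.Quotient.mkₐ k (Ideal.span E)) =
        ψ.hom.comp (Ideal.Quotient.mkₐ k (Ideal.span E)) := by
      rw [hφ, hφ, h1]
    exact CommAlgCat.hom_ext ((AlgHom.cancel_right (Ideal.Quotient.mkₐ_surjective k _)).1 h2)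
  · obtain ⟨c, h, rfl⟩ := hsurj Y p
    have h1 : ∀ a ∈ Ideal.span E, MvPolynomial.aeval c a = 0 := by
      intro a ha
      have : Ideal.span E ≤ RingHom.ker (MvPolynomial.aeval (R := k) c) :=
        Ideal.span_le.2 fun e he => (hE Y c).1 h e he
      exact this ha
    have e : (fun i => CommAlgCat.ofHom (Ideal.Quotient.liftₐ (Ideal.span E)
        (MvPolynomial.aeval c) h1) (Ideal.Quotient.mk (Ideal.span E) (MvPolynomial.X i))) = c := by
      funext i
      exact (MvPolynomial.aeval_X c i)
    refine ⟨CommAlgCat.ofHom (Ideal.Quotient.liftₐ (Ideal.span E) (MvPolynomial.aeval c) h1), ?_⟩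
    simp only [e]
  · exact (hmap Y Y' g _ (hgood Y φ) (hgood Y' (φ ≫ g))).symm

end ClosedConditions

/-! ### Coordinates on Z_r: representability and finite type -/

section Coordinates

variable {k : Type u} [Field k] {n l : ℕ} {R S : Type u} [CommRing R] [Algebra k R]
  [CommRing S] [Algebra k S] {f : Fin l → MvPolynomial (Fin n ⊕ Fin l) k} {N : ℕ}

/-- The index set of the coefficients of `q`, `x`, `y`, `q⁻¹ Q(x, y)` and its inverse. -/
abbrev CoordIndex (n l N s : ℕ) : Type :=
  Fin N ⊕ (Fin n × Fin ((s + 2) * N)) ⊕ (Fin l × Fin ((s + 1) * N)) ⊕ Fin (s * N) ⊕ Fin (s * N)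

variable {s : ℕ}

/-- The monic polynomial of degree `N` with given coefficients. -/
noncomputable def coordQ (c : CoordIndex n l N s → R) : R[X] :=
  Polynomial.X ^ N + ofCoeffs fun j => c (Sum.inl j)

/-- The polynomials representing `x` and `y`. -/
noncomputable def coordZ (c : CoordIndex n l N s → R) : Fin n ⊕ Fin l → R[X] :=
  Sum.elim (fun i => ofCoeffs fun j => c (Sum.inr (Sum.inl (i, j))))
    (fun i => ofCoeffs fun j => c (Sum.inr (Sum.inr (Sum.inl (i, j)))))

/-- The polynomial representing `q⁻¹ Q(x, y)`. -/
noncomputable def coordV (c : CoordIndex n l N s → R) : R[X] :=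
  ofCoeffs fun j => c (Sum.inr (Sum.inr (Sum.inr (Sum.inl j))))

/-- The polynomial representing the inverse of `q⁻¹ Q(x, y)`. -/
noncomputable def coordW (c : CoordIndex n l N s → R) : R[X] :=
  ofCoeffs fun j => c (Sum.inr (Sum.inr (Sum.inr (Sum.inr j))))

theorem isMonicDeg_coordQ (c : CoordIndex n l N s → R) : IsMonicDeg N (coordQ c) := by
  constructor
  · rw [Polynomial.natDegree_le_iff_coeff_eq_zero]
    intro d hd
    rw [coordQ, Polynomial.coeff_add, coeff_ofCoeffs_of_le _ hd.le, Polynomial.coeff_X_pow,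
      if_neg hd.ne', add_zero]
  · rw [coordQ, Polynomial.coeff_add, coeff_ofCoeffs_of_le _ le_rfl, Polynomial.coeff_X_pow_self,
      add_zero]

theorem coordQ_map (φ : R →ₐ[k] S) (c : CoordIndex n l N s → R) :
    (coordQ c).map (φ : R →+* S) = coordQ fun i => φ (c i) := by
  rw [coordQ, coordQ, Polynomial.map_add, ofCoeffs_map, Polynomial.map_pow, Polynomial.map_X]
  rfl

theorem coordZ_map (φ : R →ₐ[k] S) (c : CoordIndex n l N s → R) (i : Fin n ⊕ Fin l) :
    (coordZ c i).map (φ : R →+* S) = coordZ (fun i => φ (c i)) i := by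
  rcases i with i | i <;> exact ofCoeffs_map _ _

theorem coordV_map (φ : R →ₐ[k] S) (c : CoordIndex n l N s → R) :
    (coordV c).map (φ : R →+* S) = coordV fun i => φ (c i) := ofCoeffs_map _ _

theorem coordW_map (φ : R →ₐ[k] S) (c : CoordIndex n l N s → R) :
    (coordW c).map (φ : R →+* S) = coordW fun i => φ (c i) := ofCoeffs_map _ _

theorem aeval_coordZ_map (φ : R →ₐ[k] S) (c : CoordIndex n l N s → R)
    (F : MvPolynomial (Fin n ⊕ Fin l) k) :
    (MvPolynomial.aeval (coordZ c) F).map (φ : R →+* S) =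
      MvPolynomial.aeval (coordZ fun i => φ (c i)) F := by
  have h : coordZ (fun i => φ (c i)) = fun i => Polynomial.mapAlgHom φ (coordZ c i) :=
    funext fun i => (coordZ_map φ c i).symm
  rw [h, aeval_map]
  rfl

variable (f) in
/-- The equations of `Z_r`, `r = s + 2`. -/
def CoordEquations (s N : ℕ) (R : Type u) [CommRing R] [Algebra k R]
    (c : CoordIndex n l N s → R) : Prop :=
  ((∀ i, coordQ c ^ (s + 1) ∣ MvPolynomial.aeval (coordZ c) (f i)) ∧
    (∀ i, coordQ c ^ (s + 2) ∣ MvPolynomial.aeval (coordZ c) (newtonPoly f i))) ∧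
  coordQ c ^ (s + 1) ∣ MvPolynomial.aeval (coordZ c) (jacDet f) - coordQ c * coordV c ∧
  coordQ c ^ s ∣ coordV c * coordW c - 1

theorem isClosedCondition_coordEquations (s N : ℕ) :
    IsClosedCondition k (CoordEquations f s N) := by
  have key : ∀ (m : ℕ) (G : ∀ (R : Type u) [CommRing R] [Algebra k R],
      (CoordIndex n l N s → R) → R[X]),
      (∀ (R S : Type u) [CommRing R] [Algebra k R] [CommRing S] [Algebra k S] (φ : R →ₐ[k] S)
        (c : CoordIndex n l N s → R), (G R c).map (φ : R →+* S) = G S (fun i => φ (c i))) →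
      IsClosedCondition k fun R _ _ c => coordQ c ^ m ∣ G R c := fun m G hG =>
    isClosedCondition_dvd (fun R _ _ c => (isMonicDeg_coordQ c).monic.pow m)
      (fun R S _ _ _ _ φ c => by rw [Polynomial.map_pow, coordQ_map]) hG
  refine IsClosedCondition.and (IsClosedCondition.and (IsClosedCondition.forall fun i => ?_)
    (IsClosedCondition.forall fun i => ?_)) (IsClosedCondition.and ?_ ?_)
  · exact key (s + 1) (fun R _ _ c => MvPolynomial.aeval (coordZ c) (f i))
      fun R S _ _ _ _ φ c => aeval_coordZ_map φ c _
  · exact key (s + 2) (fun R _ _ c => MvPolynomial.aeval (coordZ c) (newtonPoly f i))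
      fun R S _ _ _ _ φ c => aeval_coordZ_map φ c _
  · exact key (s + 1)
      (fun R _ _ c => MvPolynomial.aeval (coordZ c) (jacDet f) - coordQ c * coordV c)
      fun R S _ _ _ _ φ c => by
        rw [Polynomial.map_sub, Polynomial.map_mul, aeval_coordZ_map, coordQ_map, coordV_map]
  · exact key s (fun R _ _ c => coordV c * coordW c - 1) fun R S _ _ _ _ φ c => by
      rw [Polynomial.map_sub, Polynomial.map_mul, coordV_map, coordW_map, Polynomial.map_one]

/-- The equations fix q⁻¹ Q only modulo q ^ s, so the exact cofactor is `coordV c` plus a multiple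
of q ^ s, which for s ≥ 1 does not affect coprimality with q. -/
theorem CoordEquations.isNewton {c : CoordIndex n l N s → R} (h : CoordEquations f s N R c) :
    IsNewton f s (coordQ c) (coordZ c) := by
  obtain ⟨⟨h1, h2⟩, ⟨e, he⟩, e', he'⟩ := h
  refine ⟨h1, ⟨coordV c + coordQ c ^ s * e, by linear_combination he, fun hs => ?_⟩, h2⟩
  obtain ⟨m, rfl⟩ := Nat.exists_eq_add_of_le' hs
  rw [pow_succ', mul_assoc]
  refine IsCoprime.add_mul_left_left ⟨coordW c, -coordQ c ^ m * e', ?_⟩ _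
  linear_combination he'

/-- The point with given coordinates. -/
noncomputable def NewtonPoint.ofCoord (c : CoordIndex n l N s → R)
    (h : CoordEquations f s N R c) : NewtonPoint f N s R :=
  NewtonPoint.mk' (isMonicDeg_coordQ c) (coordZ c) h.isNewton

theorem NewtonPoint.mk'_congr {q q' : R[X]} {hq : IsMonicDeg N q} {hq' : IsMonicDeg N q'}
    {z z' : Fin n ⊕ Fin l → R[X]} {h : IsNewton f s q z} {h' : IsNewton f s q' z'}
    (e : q = q') (e' : z = z') : NewtonPoint.mk' hq z h = NewtonPoint.mk' hq' z' h' := by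
  subst e e'
  rfl

theorem IsMonicDeg.eq_of_dvd_ofCoeffs_sub {q : R[X]} (hq : IsMonicDeg N q) {r : ℕ}
    {a b : Fin (r * N) → R} (h : q ^ r ∣ ofCoeffs a - ofCoeffs b) : a = b := by
  have h1 := Polynomial.modByMonic_eq_of_dvd_sub (hq.pow r).monic h
  rw [(hq.pow r).modByMonic_ofCoeffs, (hq.pow r).modByMonic_ofCoeffs] at h1
  funext j
  rw [← coeff_ofCoeffs a, h1, coeff_ofCoeffs]

/-- Remainders are unique, and the two auxiliary polynomials carry no extra information: regularity
of q determines q⁻¹ Q modulo q ^ s, and an inverse modulo q ^ s is unique. -/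
theorem NewtonPoint.ofCoord_injective {c c' : CoordIndex n l N s → R}
    (h : CoordEquations f s N R c) (h' : CoordEquations f s N R c')
    (e : NewtonPoint.ofCoord c h = NewtonPoint.ofCoord c' h') : c = c' := by
  have hq : coordQ c = coordQ c' := congrArg NewtonPoint.q e
  have hm := isMonicDeg_coordQ c
  have e2 : NewtonPoint.mk' hm (coordZ c) h.isNewton =
      NewtonPoint.mk' hm (coordZ c') (hq ▸ h'.isNewton) :=
    e.trans (NewtonPoint.mk'_congr hq.symm rfl)
  obtain ⟨hx, hy⟩ := NewtonPoint.mk'_eq_mk'.1 e2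
  have hx' : ∀ i, _ := fun i => hm.eq_of_dvd_ofCoeffs_sub (hx i)
  have hy' : ∀ i, _ := fun i => hm.eq_of_dvd_ofCoeffs_sub (hy i)
  have hz : coordZ c = coordZ c' := by
    funext i
    rcases i with i | i
    · exact congrArg ofCoeffs (hx' i)
    · exact congrArg ofCoeffs (hy' i)
  obtain ⟨-, ⟨a, ha⟩, ⟨b, hb⟩⟩ := h
  obtain ⟨-, ⟨a', ha'⟩, ⟨b', hb'⟩⟩ := h'
  rw [← hq, ← hz] at ha'
  rw [← hq] at hb'
  have hv : coordQ c ^ s ∣ coordV c - coordV c' := ⟨a' - a, hm.monic.isRegular.left (by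
    simp only
    linear_combination ha' - ha)⟩
  have hv' := hm.eq_of_dvd_ofCoeffs_sub hv
  have hvv : coordV c = coordV c' := congrArg ofCoeffs hv'
  have hw : coordQ c ^ s ∣ coordW c - coordW c' := by
    rw [← hvv] at hb'
    refine ⟨coordW c * -b' + coordW c' * b, ?_⟩
    linear_combination coordW c' * hb - coordW c * hb'
  have hw' := hm.eq_of_dvd_ofCoeffs_sub hw
  funext i
  rcases i with j | ⟨i, j⟩ | ⟨i, j⟩ | j | j
  · have := congrArg (fun g => g.coeff j.1) hq
    simpa [coordQ, coeff_ofCoeffs] using this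
  · exact congrFun (hx' i) j
  · exact congrFun (hy' i) j
  · exact congrFun hv' j
  · exact congrFun hw' j

theorem IsMonicDeg.exists_ofCoeffs {q : R[X]} (hq : IsMonicDeg N q) (r : ℕ) (g : R[X]) :
    ∃ a : Fin (r * N) → R, q ^ r ∣ ofCoeffs a - g := by
  refine ⟨fun j => (g %ₘ q ^ r).coeff j, -(g /ₘ q ^ r), ?_⟩
  rw [ofCoeffs_coeff fun d hd => (hq.pow r).coeff_modByMonic g hd]
  have := Polynomial.modByMonic_add_div g (q ^ r)
  linear_combination this

theorem NewtonPoint.exists_ofCoord_eq (p : NewtonPoint f N s R) :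
    ∃ c h, NewtonPoint.ofCoord c h = p := by
  obtain ⟨q, hq, z, h, rfl⟩ := p.exists_eq_mk'
  obtain ⟨w, hw, hc⟩ := h.det
  -- For s = 0 the congruence is modulo 1, and the index sets of the auxiliary coordinates are
  -- empty; this matches the absence of a unit condition for r = 2.
  have hinv : ∃ a, q ^ s ∣ w * a - 1 := by
    rcases Nat.eq_zero_or_pos s with rfl | hs
    · exact ⟨0, by simp⟩
    · obtain ⟨a, b, hab⟩ := (hc hs).pow_right (n := s)
      exact ⟨a, -b, by linear_combination hab⟩
  obtain ⟨a, ha⟩ := hinv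
  choose cx hcx using fun i => hq.exists_ofCoeffs (s + 2) (z (Sum.inl i))
  choose cy hcy using fun i => hq.exists_ofCoeffs (s + 1) (z (Sum.inr i))
  obtain ⟨cv, hcv⟩ := hq.exists_ofCoeffs s w
  obtain ⟨cw, hcw⟩ := hq.exists_ofCoeffs s a
  let c : CoordIndex n l N s → R := Sum.elim (fun j => q.coeff j) (Sum.elim (fun i => cx i.1 i.2)
    (Sum.elim (fun i => cy i.1 i.2) (Sum.elim cv cw)))
  have hcq : coordQ c = q := by
    ext d
    rw [coordQ, Polynomial.coeff_add, Polynomial.coeff_X_pow]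
    rcases lt_trichotomy d N with hd | rfl | hd
    · rw [if_neg hd.ne, zero_add]
      exact coeff_ofCoeffs _ ⟨d, hd⟩
    · rw [if_pos rfl, coeff_ofCoeffs_of_le _ le_rfl, add_zero, hq.2]
    · rw [if_neg hd.ne', coeff_ofCoeffs_of_le _ hd.le, add_zero,
        Polynomial.coeff_eq_zero_of_natDegree_lt (hq.1.trans_lt hd)]
  have hN : IsNewton f s q (coordZ c) := h.congr hcx hcy
  have hdet : q ^ (s + 1) ∣ MvPolynomial.aeval (coordZ c) (jacDet f) - q * w := by
    rw [← hw]
    refine Ideal.mem_span_singleton.1 ?_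
    have := aeval_add_sub_mem (Ideal.span {q ^ (s + 1)}) z (coordZ c - z) ?_ (jacDet f)
    · rwa [add_sub_cancel] at this
    · rintro (i | i)
      · exact Ideal.mem_span_singleton.2 ((pow_dvd_pow _ (Nat.le_succ _)).trans (hcx i))
      · exact Ideal.mem_span_singleton.2 (hcy i)
  refine ⟨c, ⟨⟨?_, ?_⟩, ?_, ?_⟩, ?_⟩
  · rw [hcq]
    exact hN.eqn
  · rw [hcq]
    exact hN.adj
  · rw [hcq]
    have h1 : q ^ (s + 1) ∣ q * (coordV c - w) := by
      rw [pow_succ']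
      exact mul_dvd_mul_left _ hcv
    have := dvd_sub hdet h1
    convert! this using 1
    ring
  · rw [hcq]
    have h1 : q ^ s ∣ (coordV c - w) * coordW c := Dvd.dvd.mul_right hcv _
    have h2 : q ^ s ∣ w * (coordW c - a) := Dvd.dvd.mul_left hcw _
    have := dvd_add (dvd_add h1 h2) ha
    convert! this using 1
    ring
  · refine (NewtonPoint.mk'_congr (h' := hN) (hq' := hq) hcq rfl).trans ?_
    exact NewtonPoint.mk'_eq_mk'.2 ⟨hcx, hcy⟩

variable (f N s)

theorem exists_corepresentableBy_newtonFunctor :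
    ∃ (A : Type u) (_ : CommRing A) (_ : Algebra k A), Algebra.FiniteType k A ∧
      Nonempty ((newtonFunctor f N s).CorepresentableBy (CommAlgCat.of k A)) :=
  exists_corepresentableBy (isClosedCondition_coordEquations s N)
    (fun _ c h => NewtonPoint.ofCoord c h) (fun _ _ _ h h' e => NewtonPoint.ofCoord_injective h h' e)
    (fun _ p => NewtonPoint.exists_ofCoord_eq p)
    (fun _ _ φ c h _ => NewtonPoint.mk'_congr (h := h.isNewton.polynomialMap φ.hom)
      (coordQ_map φ.hom c)
      (funext fun i => coordZ_map φ.hom c i))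

end Coordinates

/-! ### Dimension of algebras étale over polynomial rings -/

section Dimension

variable {K : Type*} [Field K]

/-- Induction on the number of variables: by the Jacobson property a maximal ideal contracts to a
maximal ideal in one variable fewer, and passing back up adds one to the height. -/
theorem height_eq_of_isMaximal_mvPolynomial (d : ℕ) :
    ∀ (P : Ideal (MvPolynomial (Fin d) K)) [P.IsMaximal], P.height = d := by
  induction d with
  | zero =>
    intro P hP
    have h : P = ⊥ := by
      have hf : IsField (MvPolynomial (Fin 0) K) :=
        (MvPolynomial.isEmptyAlgEquiv K (Fin 0)).toMulEquiv.isField (Field.toIsField K)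
      let := hf.toField
      exact (Ideal.eq_bot_or_top P).resolve_right hP.ne_top
    rw [h, Ideal.height_bot]
    rfl
  | succ d ih =>
    intro P hP
    let e := (MvPolynomial.finSuccEquiv K d).toRingEquiv
    let P' : Ideal (Polynomial (MvPolynomial (Fin d) K)) := P.map e
    have hP' : P'.IsMaximal := Ideal.map_isMaximal_of_equiv e
    have h1 : P'.height = P.height := e.height_map P
    let p : Ideal (MvPolynomial (Fin d) K) := P'.comap Polynomial.C
    have h2 : p.IsMaximal := Polynomial.isMaximal_comap_C_of_isJacobsonRing P'
    have h3 : P'.LiesOver p := ⟨rfl⟩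
    rw [← h1, Polynomial.height_eq_height_add_one p P', ih]
    rfl

/-- Nested primes with the same contraction coincide, so strict chains of primes contract to strict
chains. -/
theorem ringKrullDim_le_of_quasiFinite {A B : Type*} [CommRing A] [CommRing B] [Algebra A B]
    [Algebra.QuasiFinite A B] : ringKrullDim B ≤ ringKrullDim A := by
  refine Order.krullDim_le_of_strictMono (PrimeSpectrum.comap (algebraMap A B)) fun P Q h => ?_
  refine lt_of_le_of_ne (Ideal.comap_mono h.le) fun e => h.ne ?_
  exact PrimeSpectrum.ext (Algebra.QuasiFinite.eq_of_le_of_under_eq (R := A) P.asIdeal Q.asIdeal h.le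
    (congrArg PrimeSpectrum.asIdeal e))

theorem height_eq_card_of_isMaximal_mvPolynomial {ι : Type*} [Finite ι]
    (P : Ideal (MvPolynomial ι K)) [P.IsMaximal] : P.height = Nat.card ι := by
  let e := (MvPolynomial.renameEquiv K (Finite.equivFin ι)).toRingEquiv
  have : (P.map e).IsMaximal := Ideal.map_isMaximal_of_equiv e
  rw [← e.height_map P]
  exact height_eq_of_isMaximal_mvPolynomial _ (P.map e)

/-- The field B / P is of finite type over the Jacobson ring A, hence finite over it, and
integrality makes the contraction of its zero ideal maximal. -/
theorem isMaximal_under_of_finiteType {A B : Type*} [CommRing A] [CommRing B] [Algebra A B]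
    [IsJacobsonRing A] [Algebra.FiniteType A B] (P : Ideal B) [P.IsMaximal] :
    (P.under A).IsMaximal := by
  let := Ideal.Quotient.field P
  have : Module.Finite A (B ⧸ P) := finite_of_finite_type_of_isJacobsonRing A (B ⧸ P)
  have h := Ideal.isMaximal_comap_of_isIntegral_of_isMaximal (R := A) (⊥ : Ideal (B ⧸ P))
  convert h using 1
  ext a
  rw [Ideal.mem_comap, Ideal.mem_comap, Ideal.mem_bot, IsScalarTower.algebraMap_apply A B (B ⧸ P)]
  exact Ideal.Quotient.eq_zero_iff_mem.symm

theorem ringKrullDim_eq_of_etale_mvPolynomial {ι : Type*} [Finite ι] {B : Type*} [CommRing B]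
    [Nontrivial B] [Algebra (MvPolynomial ι K) B] [Algebra.Etale (MvPolynomial ι K) B] :
    ringKrullDim B = Nat.card ι := by
  apply le_antisymm
  · refine (ringKrullDim_le_of_quasiFinite (A := MvPolynomial ι K)).trans_eq ?_
    simp
  · obtain ⟨P, hP⟩ := Ideal.exists_maximal B
    have h1 : (P.under (MvPolynomial ι K)).IsMaximal := isMaximal_under_of_finiteType P
    have : IsNoetherianRing B := Algebra.FiniteType.isNoetherianRing (MvPolynomial ι K) B
    -- Étale maps are flat and have going down, so a maximal ideal of B is at least as high as its
    -- contraction, a maximal ideal of the polynomial ring.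
    have h2 := Ideal.height_eq_height_add_of_liesOver_of_hasGoingDown
      (P.under (MvPolynomial ι K)) P
    rw [height_eq_card_of_isMaximal_mvPolynomial] at h2
    have h3 : (Nat.card ι : ℕ∞) ≤ P.height := h2 ▸ le_self_add
    exact (WithBot.coe_le_coe.2 h3).trans (Ideal.height_le_ringKrullDim_of_ne_top hP.ne_top)

open scoped TensorProduct

/-- The nontrivial fibers of an étale algebra over a polynomial ring in `d` variables have
dimension `d`. -/
theorem ringKrullDim_tensor_of_etale_mvPolynomial {ι : Type*} [Finite ι] {A B : Type*}
    [CommRing A] [CommRing B] [Algebra A B] [Algebra A K] [Algebra (MvPolynomial ι A) B]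
    [IsScalarTower A (MvPolynomial ι A) B] [Algebra.Etale (MvPolynomial ι A) B]
    [Nontrivial (K ⊗[A] B)] : ringKrullDim (K ⊗[A] B) = Nat.card ι := by
  let := MvPolynomial.algebraMvPolynomial (R := A) (S := K) (σ := ι)
  -- The fiber is the base change of B from A[ι] to K[ι], hence étale over K[ι].
  let e : MvPolynomial ι K ⊗[MvPolynomial ι A] B ≃ₐ[K] K ⊗[A] B :=
    Algebra.IsPushout.cancelBaseChangeAlg A K (MvPolynomial ι A) (MvPolynomial ι K) B
  have := e.toEquiv.nontrivial
  rw [← ringKrullDim_eq_of_ringEquiv e.toRingEquiv]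
  exact ringKrullDim_eq_of_etale_mvPolynomial (K := K) (ι := ι)
    (B := MvPolynomial ι K ⊗[MvPolynomial ι A] B)

theorem topologicalKrullDim_fiber_of_etale_mvPolynomial {ι : Type*} [Finite ι] {A B : Type u}
    [CommRing A] [CommRing B] [Algebra A B] [Algebra (MvPolynomial ι A) B]
    [IsScalarTower A (MvPolynomial ι A) B] [Algebra.Etale (MvPolynomial ι A) B]
    (p : PrimeSpectrum A)
    [h : Nonempty ((Spec.map (CommRingCat.ofHom (algebraMap A B))).fiber p)] :
    topologicalKrullDim ((Spec.map (CommRingCat.ofHom (algebraMap A B))).fiber p) =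
      Nat.card ι := by
  let e : (Spec.map (CommRingCat.ofHom (algebraMap A B))).fiber p ≅
      Spec (CommRingCat.of (p.asIdeal.ResidueField ⊗[A] B)) :=
    Arrow.leftFunc.mapIso (Spec.fiberToSpecResidueFieldIso A B p)
  have h1 : Nonempty (PrimeSpectrum (p.asIdeal.ResidueField ⊗[A] B)) := h.map e.hom
  have : Nontrivial (p.asIdeal.ResidueField ⊗[A] B) :=
    PrimeSpectrum.nonempty_iff_nontrivial.1 h1
  rw [IsHomeomorph.topologicalKrullDim_eq _ e.hom.homeomorph.isHomeomorph]
  exact (PrimeSpectrum.topologicalKrullDim_eq_ringKrullDim _).trans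
    ringKrullDim_tensor_of_etale_mvPolynomial

end Dimension

/-! ### Smoothness, and étaleness from infinitesimal lifting -/

section Smooth

theorem isStandardSmoothOfRelativeDimension_mvPolynomial (A : Type*) [CommRing A] (ι : Type*)
    [Finite ι] : Algebra.IsStandardSmoothOfRelativeDimension (Nat.card ι) A
      (MvPolynomial ι A) := by
  let P : Algebra.SubmersivePresentation A (MvPolynomial ι A) ι PEmpty.{1} :=
    { Algebra.Generators.mvPolynomial A ι with
      relation := PEmpty.elim
      span_range_relation_eq_ker := by
        rw [Set.range_eq_empty, Ideal.span_empty]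
        exact (Algebra.Generators.ker_mvPolynomial ..).symm
      map := PEmpty.elim
      map_inj := fun a => a.elim
      jacobian_isUnit := by
        rw [Algebra.PreSubmersivePresentation.jacobian_eq_jacobiMatrix_det, Matrix.det_isEmpty,
          map_one]
        exact isUnit_one }
  exact P.isStandardSmoothOfRelativeDimension (by simp [Algebra.Presentation.dimension])

/-- Étale means standard smooth of relative dimension 0, and relative dimensions add along A → A[ι]
→ B. -/
theorem smoothOfRelativeDimension_of_etale_mvPolynomial {A B : Type u} [CommRing A] [CommRing B]
    [Algebra A B] {ι : Type*} [Finite ι] [Algebra (MvPolynomial ι A) B]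
    [IsScalarTower A (MvPolynomial ι A) B] [Algebra.Etale (MvPolynomial ι A) B] :
    SmoothOfRelativeDimension (Nat.card ι) (Spec.map (CommRingCat.ofHom (algebraMap A B))) := by
  have h1 := isStandardSmoothOfRelativeDimension_mvPolynomial A ι
  have h2 := (Algebra.Etale.iff_isStandardSmoothOfRelativeDimension_zero
    (R := MvPolynomial ι A) (S := B)).1 inferInstance
  have h3 := Algebra.IsStandardSmoothOfRelativeDimension.trans (Nat.card ι) 0 A
    (MvPolynomial ι A) B
  rw [HasRingHomProperty.Spec_iff (P := @SmoothOfRelativeDimension (Nat.card ι))]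
  refine RingHom.locally_of
    (RingHom.isStandardSmoothOfRelativeDimension_respectsIso (n := Nat.card ι)) _ ?_
  rw [zero_add] at h3
  exact (RingHom.isStandardSmoothOfRelativeDimension_algebraMap _).2 h3

/-- An algebra `B` over `A[ι]` is étale if deformations of homomorphisms from `B` are given
by deformations of their restrictions to `A` and of the images of the variables. -/
theorem etale_mvPolynomial_of_existsUnique_lift {k A B : Type u} [Field k] [CommRing A]
    [Algebra k A] [Algebra.FiniteType k A] [CommRing B] [Algebra k B] [Algebra.FiniteType k B]
    {ι : Type} [Finite ι] [Algebra A B] [IsScalarTower k A B] [Algebra (MvPolynomial ι A) B]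
    [IsScalarTower A (MvPolynomial ι A) B]
    (H : ∀ {R S : Type u} [CommRing R] [Algebra k R] [CommRing S] [Algebra k S] (φ : R →ₐ[k] S),
      Function.Surjective φ → (∀ a b, φ a = 0 → φ b = 0 → a * b = 0) →
      ∀ (a : A →ₐ[k] R) (c : ι → R) (b : B →ₐ[k] S),
      b.comp (IsScalarTower.toAlgHom k A B) = φ.comp a →
      (∀ i, b (algebraMap (MvPolynomial ι A) B (MvPolynomial.X i)) = φ (c i)) →
      ∃! g : B →ₐ[k] R, (g.comp (IsScalarTower.toAlgHom k A B) = a ∧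
        ∀ i, g (algebraMap (MvPolynomial ι A) B (MvPolynomial.X i)) = c i) ∧ φ.comp g = b) :
    Algebra.Etale (MvPolynomial ι A) B := by
  have t1 : IsScalarTower k (MvPolynomial ι A) B := .of_algebraMap_eq fun x => by
    rw [IsScalarTower.algebraMap_apply k A B, IsScalarTower.algebraMap_apply A (MvPolynomial ι A) B,
      IsScalarTower.algebraMap_apply k A (MvPolynomial ι A)]
  have : IsNoetherianRing A := Algebra.FiniteType.isNoetherianRing k A
  have : Algebra.FiniteType (MvPolynomial ι A) B :=
    Algebra.FiniteType.of_restrictScalars_finiteType k (MvPolynomial ι A) B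
  have : Algebra.FinitePresentation (MvPolynomial ι A) B :=
    Algebra.FinitePresentation.of_finiteType.1 this
  have : Algebra.FormallyEtale (MvPolynomial ι A) B := by
    rw [Algebra.FormallyEtale.iff_comp_bijective]
    intro T _ _ I hI
    let : Algebra k T := Algebra.compHom T (algebraMap k (MvPolynomial ι A))
    have t2 : IsScalarTower k (MvPolynomial ι A) T := .of_algebraMap_eq fun x => rfl
    -- An A[ι]-structure on T amounts to a homomorphism A → T and a family of elements of T. Hence
    -- `H`, which speaks of k-algebras, yields unique lifting over A[ι].
    have key : ∀ b : B →ₐ[MvPolynomial ι A] T ⧸ I, ∃! g : B →ₐ[k] T,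
        (g.comp (IsScalarTower.toAlgHom k A B) =
          (IsScalarTower.toAlgHom k (MvPolynomial ι A) T).comp
            (IsScalarTower.toAlgHom k A (MvPolynomial ι A)) ∧
        ∀ i, g (algebraMap (MvPolynomial ι A) B (MvPolynomial.X i)) =
          algebraMap (MvPolynomial ι A) T (MvPolynomial.X i)) ∧
        (Ideal.Quotient.mkₐ k I).comp g = b.restrictScalars k := by
      intro b
      refine H (Ideal.Quotient.mkₐ k I) (Ideal.Quotient.mkₐ_surjective k I) ?_ _ _
        (b.restrictScalars k) ?_ ?_
      · intro x y hx hy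
        have := Ideal.mul_mem_mul (Ideal.Quotient.eq_zero_iff_mem.1 hx)
          (Ideal.Quotient.eq_zero_iff_mem.1 hy)
        rwa [← sq, hI] at this
      · ext x
        change b (algebraMap A B x) = Ideal.Quotient.mk I (algebraMap (MvPolynomial ι A) T _)
        rw [IsScalarTower.algebraMap_apply A (MvPolynomial ι A) B, b.commutes]
        rfl
      · intro i
        exact b.commutes _
    constructor
    · intro g g' h
      have hg : ∀ g : B →ₐ[MvPolynomial ι A] T,
          ((g.restrictScalars k).comp (IsScalarTower.toAlgHom k A B) =
            (IsScalarTower.toAlgHom k (MvPolynomial ι A) T).comp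
              (IsScalarTower.toAlgHom k A (MvPolynomial ι A)) ∧
          ∀ i, g.restrictScalars k (algebraMap (MvPolynomial ι A) B (MvPolynomial.X i)) =
            algebraMap (MvPolynomial ι A) T (MvPolynomial.X i)) := by
        refine fun g => ⟨?_, fun i => g.commutes _⟩
        ext x
        change g (algebraMap A B x) = algebraMap (MvPolynomial ι A) T _
        rw [IsScalarTower.algebraMap_apply A (MvPolynomial ι A) B, g.commutes]
        rfl
      have e : g.restrictScalars k = g'.restrictScalars k :=
        (key ((Ideal.Quotient.mkₐ _ I).comp g)).unique ⟨hg g, rfl⟩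
          ⟨hg g', AlgHom.ext fun x => (DFunLike.congr_fun h x).symm⟩
      exact AlgHom.ext fun x => DFunLike.congr_fun e x
    · intro b
      obtain ⟨g, ⟨⟨h1, h2⟩, h3⟩, -⟩ := key b
      have h4 : (g : B →+* T).comp (algebraMap (MvPolynomial ι A) B) =
          algebraMap (MvPolynomial ι A) T := by
        refine MvPolynomial.ringHom_ext (fun x => ?_) h2
        have := DFunLike.congr_fun h1 x
        change g (algebraMap A B x) = _ at this
        rw [IsScalarTower.algebraMap_apply A (MvPolynomial ι A) B] at this
        exact this
      refine ⟨⟨(g : B →+* T), fun x => DFunLike.congr_fun h4 x⟩, ?_⟩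
      exact AlgHom.ext fun x => DFunLike.congr_fun h3 x
  exact { }

end Smooth

/-! ### From corepresentable functors on algebras to schemes -/

section Representability

open Opposite

variable {k : Type u} [Field k] {F G : CommAlgCat.{u} k ⥤ Type u} {X Y : CommAlgCat.{u} k}

variable (k) in
/-- `Spec` as a functor from `k`-algebras to schemes over `k`. -/
noncomputable def specFunctor : (CommAlgCat.{u} k)ᵒᵖ ⥤ Over (Spec (CommRingCat.of k)) :=
  algSpec (CommRingCat.of k)

instance full_specFunctor : (specFunctor k).Full :=
  algSpec.instFull (R := CommRingCat.of k)

instance faithful_specFunctor : (specFunctor k).Faithful :=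
  algSpec.instFaithful (R := CommRingCat.of k)

/-- Products and limits of towers found among algebras thereby remain such among all k-schemes, not
only affine ones. -/
instance preservesLimitsOfShape_specFunctor {J : Type} [SmallCategory J] :
    PreservesLimitsOfShape J (specFunctor k) :=
  (preservesLimitsOfSize_algSpec (R := CommRingCat.of k)).preservesLimitsOfShape

/-- The points of the spectrum of a `k`-algebra. -/
noncomputable def pointEquiv (r : F.CorepresentableBy X) (R : CommAlgCat.{u} k) :
    F.obj R ≃ ((specFunctor k).obj (op R) ⟶ (specFunctor k).obj (op X)) :=
  Equiv.ofBijective (fun p => (specFunctor k).map (r.homEquiv.symm p).op)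
    ⟨fun p p' h => r.homEquiv.symm.injective
      (Quiver.Hom.op_inj ((specFunctor k).map_injective h)), fun g => by
      obtain ⟨g, rfl⟩ := (specFunctor k).map_surjective g
      refine ⟨r.homEquiv g.unop, ?_⟩
      beta_reduce
      rw [Equiv.symm_apply_apply]
      rfl⟩

/-- A functor corepresented by a `k`-algebra is the functor of points of its spectrum. -/
noncomputable def pointFunctorIso (r : F.CorepresentableBy X) :
    (pointFunctor k).obj ((specFunctor k).obj (op X)) ≅ F :=
  (NatIso.ofComponents (fun R => (pointEquiv r R).toIso) (by
    intro R S φ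
    ext p
    change (specFunctor k).map (r.homEquiv.symm (F.map φ p)).op =
      (specFunctor k).map φ.op ≫ (specFunctor k).map (r.homEquiv.symm p).op
    rw [← Functor.map_comp, ← op_comp]
    refine congrArg (fun g => (specFunctor k).map (Quiver.Hom.op g)) ?_
    rw [Equiv.symm_apply_eq, r.homEquiv_comp, Equiv.apply_symm_apply])).symm

theorem pointFunctorIso_hom_app (r : F.CorepresentableBy X) {R : CommAlgCat.{u} k} (g : X ⟶ R) :
    (pointFunctorIso r).hom.app R ((specFunctor k).map g.op) = r.homEquiv g := by
  change (pointEquiv r R).symm _ = _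
  rw [Equiv.symm_apply_eq]
  change _ = (specFunctor k).map (r.homEquiv.symm _).op
  rw [Equiv.symm_apply_apply]

/-- The homomorphism of corepresenting algebras induced by a map of functors. -/
def corepHom (rF : F.CorepresentableBy X) (rG : G.CorepresentableBy Y) (α : F ⟶ G) : Y ⟶ X :=
  rG.homEquiv.symm (α.app X (rF.homEquiv (𝟙 X)))

theorem homEquiv_corepHom_comp (rF : F.CorepresentableBy X) (rG : G.CorepresentableBy Y)
    (α : F ⟶ G) {R : CommAlgCat.{u} k} (g : X ⟶ R) :
    rG.homEquiv (corepHom rF rG α ≫ g) = α.app R (rF.homEquiv g) := by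
  rw [rG.homEquiv_comp, corepHom, Equiv.apply_symm_apply, ← NatTrans.naturality_apply,
    ← rF.homEquiv_comp, Category.id_comp]

theorem map_corepHom_comp_pointFunctorIso (rF : F.CorepresentableBy X)
    (rG : G.CorepresentableBy Y) (α : F ⟶ G) :
    (pointFunctor k).map ((specFunctor k).map (corepHom rF rG α).op) ≫
      (pointFunctorIso rG).hom = (pointFunctorIso rF).hom ≫ α := by
  ext R g
  obtain ⟨g, rfl⟩ := (specFunctor k).map_surjective g
  have h : (specFunctor k).map g ≫
      (specFunctor k).map (corepHom rF rG α).op =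
      (specFunctor k).map (corepHom rF rG α ≫ g.unop).op :=
    ((specFunctor k).map_comp _ _).symm
  refine (congrArg ((pointFunctorIso rG).hom.app R) h).trans ?_
  refine (pointFunctorIso_hom_app rG (corepHom rF rG α ≫ g.unop)).trans ?_
  rw [homEquiv_corepHom_comp]
  exact congrArg (α.app R) (pointFunctorIso_hom_app rF g.unop).symm

variable (k) in
/-- The affine space as the spectrum of a polynomial ring. -/
noncomputable def affineSpaceIso (I : Type) : (specFunctor k).obj
    (op (CommAlgCat.of k (MvPolynomial (ULift.{u} I) k))) ≅ affineSpace k I :=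
  Over.isoMk (AffineSpace.SpecIso (ULift.{u} I) (CommRingCat.of k)).symm
    (AffineSpace.SpecIso_inv_over (CommRingCat.of k))

/-- If `F` is the product of `G` and an affine space, then the same holds for the representing
schemes. -/
theorem exists_isLimit_binaryFan (rF : F.CorepresentableBy X) (rG : G.CorepresentableBy Y)
    (α : F ⟶ G) {I : Type} (δ : ∀ R : CommAlgCat.{u} k, F.obj R → I → R)
    (hδ : ∀ {R S : CommAlgCat.{u} k} (φ : R ⟶ S) (p : F.obj R),
      δ S (F.map φ p) = fun i => φ.hom (δ R p i))
    (H : ∀ (R : CommAlgCat.{u} k) (p : G.obj R) (c : I → R),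
      ∃! P : F.obj R, α.app R P = p ∧ δ R P = c) :
    ∃ p : (specFunctor k).obj (op X) ⟶ affineSpace k I,
      Nonempty (IsLimit (BinaryFan.mk
        ((specFunctor k).map (corepHom rF rG α).op) p)) := by
  let d : CommAlgCat.of k (MvPolynomial (ULift.{u} I) k) ⟶ X :=
    CommAlgCat.ofHom (MvPolynomial.aeval fun i => δ X (rF.homEquiv (𝟙 X)) i.down)
  have hd : ∀ {R : CommAlgCat.{u} k} (g : X ⟶ R) (i : I),
      (d ≫ g).hom (MvPolynomial.X ⟨i⟩) = δ R (rF.homEquiv g) i := by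
    intro R g i
    have h1 : rF.homEquiv g = F.map g (rF.homEquiv (𝟙 X)) := by
      rw [← rF.homEquiv_comp, Category.id_comp]
    rw [h1, hδ]
    change g.hom (MvPolynomial.aeval _ (MvPolynomial.X _)) = _
    rw [MvPolynomial.aeval_X]
  -- By Yoneda, `H` says that X is the coproduct of Y and the polynomial algebra among k-algebras.
  have key : ∀ (R : CommAlgCat.{u} k) (a : Y ⟶ R)
      (c : CommAlgCat.of k (MvPolynomial (ULift.{u} I) k) ⟶ R),
      ∃! g : X ⟶ R, corepHom rF rG α ≫ g = a ∧ d ≫ g = c := by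
    intro R a c
    have hc : ∀ g : X ⟶ R, d ≫ g = c ↔
        δ R (rF.homEquiv g) = fun i => c.hom (MvPolynomial.X ⟨i⟩) := by
      intro g
      constructor
      · intro h
        funext i
        rw [← hd, h]
      · intro h
        refine CommAlgCat.hom_ext (MvPolynomial.algHom_ext fun i => ?_)
        exact (hd g i.down).trans (congrFun h i.down)
    have ha : ∀ g : X ⟶ R, corepHom rF rG α ≫ g = a ↔
        α.app R (rF.homEquiv g) = rG.homEquiv a := by
      intro g
      rw [← homEquiv_corepHom_comp rF rG, rG.homEquiv.apply_eq_iff_eq]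
    obtain ⟨P, hP, hP'⟩ := H R (rG.homEquiv a) fun i => c.hom (MvPolynomial.X ⟨i⟩)
    refine ⟨rF.homEquiv.symm P, ?_, fun g hg => ?_⟩
    · change corepHom rF rG α ≫ _ = a ∧ _
      rwa [ha, hc, Equiv.apply_symm_apply]
    · replace hg : corepHom rF rG α ≫ g = a ∧ d ≫ g = c := hg
      rw [ha, hc] at hg
      rw [Equiv.eq_symm_apply]
      exact hP' _ hg
  choose g hg hg' using key
  have hl : IsLimit (BinaryFan.mk (corepHom rF rG α).op d.op) :=
    BinaryFan.IsLimit.mk _ (fun a c => (g _ a.unop c.unop).op)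
      (fun a c => Quiver.Hom.unop_inj (hg _ a.unop c.unop).1)
      (fun a c => Quiver.Hom.unop_inj (hg _ a.unop c.unop).2)
      (fun a c m h1 h2 => Quiver.Hom.unop_inj (hg' _ a.unop c.unop m.unop
        ⟨congrArg Quiver.Hom.unop h1, congrArg Quiver.Hom.unop h2⟩))
  have hl' := mapIsLimitOfPreservesOfIsLimit (specFunctor k) _ _ hl
  exact ⟨(specFunctor k).map d.op ≫ (affineSpaceIso k I).hom,
    ⟨BinaryFan.isLimitCompRightIso _ (affineSpaceIso k I).hom hl'⟩⟩

/-- The product of a corepresentable functor and an affine space is corepresentable. -/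
theorem nonempty_corepresentableBy_mvPolynomial {A : Type u} [CommRing A] [Algebra k A]
    (rG : G.CorepresentableBy (CommAlgCat.of k A))
    (α : F ⟶ G) {I : Type} (δ : ∀ R : CommAlgCat.{u} k, F.obj R → I → R)
    (hδ : ∀ {R S : CommAlgCat.{u} k} (φ : R ⟶ S) (p : F.obj R),
      δ S (F.map φ p) = fun i => φ.hom (δ R p i))
    (H : ∀ (R : CommAlgCat.{u} k) (p : G.obj R) (c : I → R),
      ∃! P : F.obj R, α.app R P = p ∧ δ R P = c) :
    Nonempty (F.CorepresentableBy (CommAlgCat.of k (MvPolynomial I A))) := by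
  let C : CommAlgCat.of k A ⟶ CommAlgCat.of k (MvPolynomial I A) :=
    CommAlgCat.ofHom (IsScalarTower.toAlgHom k A (MvPolynomial I A))
  choose e he he' using H
  have hnat : ∀ {R S : CommAlgCat.{u} k} (φ : R ⟶ S) (p : G.obj R) (c : I → R),
      F.map φ (e R p c) = e S (G.map φ p) fun i => φ.hom (c i) := by
    intro R S φ p c
    refine he' _ _ _ _ ⟨?_, ?_⟩
    · rw [NatTrans.naturality_apply, (he R p c).1]
    · rw [hδ, (he R p c).2]
  let Φ (R : CommAlgCat.{u} k) (g : CommAlgCat.of k (MvPolynomial I A) ⟶ R) : F.obj R :=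
    e R (rG.homEquiv (C ≫ g)) fun i => g.hom (MvPolynomial.X i)
  have hΦ : ∀ R, Function.Bijective (Φ R) := by
    intro R
    constructor
    · intro g g' h
      have h1 : rG.homEquiv (C ≫ g) = rG.homEquiv (C ≫ g') := by
        rw [← (he R (rG.homEquiv (C ≫ g)) fun i => g.hom (MvPolynomial.X i)).1,
          ← (he R (rG.homEquiv (C ≫ g')) fun i => g'.hom (MvPolynomial.X i)).1]
        exact congrArg _ h
      have h2 : (fun i => g.hom (MvPolynomial.X i)) = fun i => g'.hom (MvPolynomial.X i) := by
        rw [← (he R (rG.homEquiv (C ≫ g)) fun i => g.hom (MvPolynomial.X i)).2,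
          ← (he R (rG.homEquiv (C ≫ g')) fun i => g'.hom (MvPolynomial.X i)).2]
        exact congrArg _ h
      have h3 := congrArg CommAlgCat.Hom.hom (rG.homEquiv.injective h1)
      refine CommAlgCat.hom_ext (AlgHom.coe_ringHom_injective
        (MvPolynomial.ringHom_ext (fun x => DFunLike.congr_fun h3 x) (congrFun h2)))
    · intro P
      let a : A →ₐ[k] R := (rG.homEquiv.symm (α.app R P)).hom
      let g : MvPolynomial I A →ₐ[k] R :=
        { MvPolynomial.eval₂Hom (a : A →+* R) (δ R P) with
          commutes' := fun x => by
            rw [IsScalarTower.algebraMap_apply k A (MvPolynomial I A)]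
            exact (MvPolynomial.eval₂Hom_C _ _ _).trans (a.commutes x) }
      refine ⟨CommAlgCat.ofHom g, (he' _ _ _ _ ⟨?_, ?_⟩).symm⟩
      · have : C ≫ CommAlgCat.ofHom g = rG.homEquiv.symm (α.app R P) :=
          CommAlgCat.hom_ext (AlgHom.ext fun x => MvPolynomial.eval₂Hom_C (a : A →+* R) _ x)
        rw [this, Equiv.apply_symm_apply]
      · funext i
        exact (MvPolynomial.eval₂Hom_X' (a : A →+* R) _ i).symm
  exact ⟨{ homEquiv := fun {R} => Equiv.ofBijective (Φ R) (hΦ R)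
           homEquiv_comp := fun {R S} φ g => by
            change Φ S (g ≫ φ) = F.map φ (Φ R g)
            rw [hnat, ← rG.homEquiv_comp, Category.assoc]
            rfl }⟩

/-- A sequence of compatible morphisms is a limit cone if it has the universal property. -/
theorem nonempty_isLimit_towerCone {C : Type*} [Category* C] {X : ℕ → C}
    {τ : ∀ s, X (s + 1) ⟶ X s} {Z : C} {π : ∀ s, Z ⟶ X s} (h : ∀ s, π (s + 1) ≫ τ s = π s)
    (H : ∀ (W : C) (g : ∀ s, W ⟶ X s), (∀ s, g (s + 1) ≫ τ s = g s) →
      ∃! u : W ⟶ Z, ∀ s, u ≫ π s = g s) : Nonempty (IsLimit (towerCone τ π h)) := by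
  have H' : ∀ c : Cone (Functor.ofOpSequence τ), ∃! u : c.pt ⟶ Z,
      ∀ s, u ≫ π s = c.π.app (op s) := fun c => H c.pt (fun s => c.π.app (op s)) fun s => by
    have := c.w (homOfLE (Nat.le_add_right s 1)).op
    rwa [Functor.ofOpSequence_map_homOfLE_succ] at this
  choose u hu hu' using H'
  exact ⟨{ lift := u
           fac := fun c j => hu c j.unop
           uniq := fun c m hm => hu' c m fun s => hm (op s) }⟩

/-- Functors preserving limits preserve limit cones of towers. -/
theorem nonempty_isLimit_towerCone_map {C D : Type*} [Category* C] [Category* D] (L : C ⥤ D)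
    [PreservesLimitsOfShape ℕᵒᵖ L] {X : ℕ → C}
    {τ : ∀ s, X (s + 1) ⟶ X s} {Z : C} {π : ∀ s, Z ⟶ X s} {h : ∀ s, π (s + 1) ≫ τ s = π s}
    (hl : IsLimit (towerCone τ π h)) (h' : ∀ s, L.map (π (s + 1)) ≫ L.map (τ s) = L.map (π s)) :
    Nonempty (IsLimit (towerCone (fun s => L.map (τ s)) (fun s => L.map (π s)) h')) := by
  have hL := isLimitOfPreserves L hl
  refine nonempty_isLimit_towerCone h' fun W g hg => ?_
  let c : Cone (Functor.ofOpSequence τ ⋙ L) :=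
    { pt := W
      π := NatTrans.ofOpSequence g fun s => by
        rw [Functor.comp_map, Functor.ofOpSequence_map_homOfLE_succ]
        exact (Category.id_comp _).trans (hg s).symm }
  refine ⟨hL.lift c, fun s => hL.fac c (op s), fun u hu => hL.uniq c u fun s => hu s.unop⟩

/-- If `F` is the limit of a tower of functors, then the same holds for the representing
schemes. -/
theorem nonempty_isLimit_towerCone_algSpec (rF : F.CorepresentableBy X)
    {Fs : ℕ → CommAlgCat.{u} k ⥤ Type u} {Xs : ℕ → CommAlgCat.{u} k}
    (rs : ∀ s, (Fs s).CorepresentableBy (Xs s)) (α : ∀ s, Fs (s + 1) ⟶ Fs s)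
    (β : ∀ s, F ⟶ Fs s)
    (H : ∀ (R : CommAlgCat.{u} k) (p : ∀ s, (Fs s).obj R),
      (∀ s, (α s).app R (p (s + 1)) = p s) → ∃! P : F.obj R, ∀ s, (β s).app R P = p s)
    (h : ∀ s, (specFunctor k).map (corepHom rF (rs (s + 1)) (β (s + 1))).op ≫
      (specFunctor k).map (corepHom (rs (s + 1)) (rs s) (α s)).op =
      (specFunctor k).map (corepHom rF (rs s) (β s)).op) :
    Nonempty (IsLimit (towerCone
      (fun s => (specFunctor k).map (corepHom (rs (s + 1)) (rs s) (α s)).op)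
      (fun s => (specFunctor k).map (corepHom rF (rs s) (β s)).op) h)) := by
  have h' : ∀ s, (corepHom rF (rs (s + 1)) (β (s + 1))).op ≫
      (corepHom (rs (s + 1)) (rs s) (α s)).op = (corepHom rF (rs s) (β s)).op := fun s =>
    (specFunctor k).map_injective (((specFunctor k).map_comp _ _).trans (h s))
  suffices hl : Nonempty (IsLimit (towerCone (fun s => (corepHom (rs (s + 1)) (rs s) (α s)).op)
      (fun s => (corepHom rF (rs s) (β s)).op) h')) by
    exact hl.elim fun hl => nonempty_isLimit_towerCone_map (specFunctor k) hl h
  refine nonempty_isLimit_towerCone h' ?_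
  intro W g hg
  obtain ⟨P, hP, hP'⟩ := H W.unop (fun s => (rs s).homEquiv (g s).unop) fun s => by
    rw [← homEquiv_corepHom_comp (rs (s + 1)) (rs s)]
    exact congrArg _ (congrArg Quiver.Hom.unop (hg s))
  have hu : ∀ u : X ⟶ W.unop, (∀ s, u.op ≫ (corepHom rF (rs s) (β s)).op = g s) ↔
      ∀ s, (β s).app _ (rF.homEquiv u) = (rs s).homEquiv (g s).unop := by
    intro u
    refine forall_congr' fun s => ?_
    rw [← homEquiv_corepHom_comp rF (rs s), (rs s).homEquiv.apply_eq_iff_eq]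
    exact ⟨fun h => congrArg Quiver.Hom.unop h, fun h => Quiver.Hom.unop_inj h⟩
  refine ⟨(rF.homEquiv.symm P).op, (hu _).2 ?_, fun u hu' => ?_⟩
  · rwa [Equiv.apply_symm_apply]
  · refine Quiver.Hom.unop_inj ((Equiv.eq_symm_apply _).2 (hP' _ ((hu u.unop).1 hu')))

end Representability

/-! ### Geometry of the truncation morphisms -/

section Truncations

open Opposite

variable {k : Type u} [Field k] {n l : ℕ} {f : Fin l → MvPolynomial (Fin n ⊕ Fin l) k} {N s : ℕ}

/-- The truncation homomorphisms of the corepresenting algebras are étale over polynomial rings. -/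
theorem exists_etale_of_corepresentableBy {A B : Type u} [CommRing A] [Algebra k A]
    [Algebra.FiniteType k A] [CommRing B] [Algebra k B] [Algebra.FiniteType k B]
    (rA : (newtonFunctor f N s).CorepresentableBy (CommAlgCat.of k A))
    (rB : (newtonFunctor f N (s + 1)).CorepresentableBy (CommAlgCat.of k B))
    [Algebra A B] [IsScalarTower k A B]
    (h : (corepHom rB rA (newtonTrunc f N s)).hom = IsScalarTower.toAlgHom k A B) :
    ∃ (_ : Algebra (MvPolynomial (Fin n × Fin N) A) B),
      IsScalarTower A (MvPolynomial (Fin n × Fin N) A) B ∧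
        Algebra.Etale (MvPolynomial (Fin n × Fin N) A) B := by
  let univ : NewtonPoint f N (s + 1) B := rB.homEquiv (𝟙 (CommAlgCat.of k B))
  -- The variables act on B as the digits of the universal point. A homomorphism out of B then
  -- prescribes a truncation on A and digits on the variables, so `NewtonPoint.existsUnique_lift` is
  -- exactly the required lifting property.
  let : Algebra (MvPolynomial (Fin n × Fin N) A) B :=
    (MvPolynomial.aeval (R := A) univ.digits).toRingHom.toAlgebra
  have hX : ∀ i, algebraMap (MvPolynomial (Fin n × Fin N) A) B (MvPolynomial.X i) =
      univ.digits i := MvPolynomial.aeval_X (R := A) univ.digits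
  have tower : IsScalarTower A (MvPolynomial (Fin n × Fin N) A) B :=
    .of_algebraMap_eq fun x => (MvPolynomial.aeval_C (R := A) univ.digits x).symm
  refine ⟨inferInstance, tower, etale_mvPolynomial_of_existsUnique_lift (k := k) ?_⟩
  intro R S _ _ _ _ φ hφ hker a c b hb hc
  have hdig : ∀ {R : Type u} [CommRing R] [Algebra k R] (g : B →ₐ[k] R),
      NewtonPoint.digits (rB.homEquiv (CommAlgCat.ofHom g) : NewtonPoint f N (s + 1) R) =
        fun i => g (algebraMap (MvPolynomial (Fin n × Fin N) A) B (MvPolynomial.X i)) := by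
    intro R _ _ g
    have h1 : rB.homEquiv (CommAlgCat.ofHom g) = univ.map g := by
      rw [← Category.id_comp (CommAlgCat.ofHom g), rB.homEquiv_comp]
      rfl
    rw [h1, NewtonPoint.digits_map]
    simp only [hX]
  have htr : ∀ {R : Type u} [CommRing R] [Algebra k R] (g : B →ₐ[k] R),
      NewtonPoint.trunc (rB.homEquiv (CommAlgCat.ofHom g) : NewtonPoint f N (s + 1) R) =
        rA.homEquiv (CommAlgCat.ofHom (g.comp (IsScalarTower.toAlgHom k A B))) := by
    intro R _ _ g
    refine (homEquiv_corepHom_comp rB rA (newtonTrunc f N s) (CommAlgCat.ofHom g)).symm.trans ?_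
    rw [← h]
    rfl
  have hmapA : ∀ (g : A →ₐ[k] R), rA.homEquiv (CommAlgCat.ofHom (φ.comp g)) =
      NewtonPoint.map φ (rA.homEquiv (CommAlgCat.ofHom g) : NewtonPoint f N s R) := fun g =>
    rA.homEquiv_comp (CommAlgCat.ofHom φ) (CommAlgCat.ofHom g)
  have hmapB : ∀ (g : B →ₐ[k] R), rB.homEquiv (CommAlgCat.ofHom (φ.comp g)) =
      NewtonPoint.map φ (rB.homEquiv (CommAlgCat.ofHom g) : NewtonPoint f N (s + 1) R) := fun g =>
    rB.homEquiv_comp (CommAlgCat.ofHom φ) (CommAlgCat.ofHom g)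
  have hinjA : ∀ {R : Type u} [CommRing R] [Algebra k R] (g g' : A →ₐ[k] R),
      rA.homEquiv (CommAlgCat.ofHom g) = rA.homEquiv (CommAlgCat.ofHom g') → g = g' :=
    fun g g' e => congrArg CommAlgCat.Hom.hom (rA.homEquiv.injective e)
  have hinjB : ∀ {R : Type u} [CommRing R] [Algebra k R] (g g' : B →ₐ[k] R),
      rB.homEquiv (CommAlgCat.ofHom g) = rB.homEquiv (CommAlgCat.ofHom g') → g = g' :=
    fun g g' e => congrArg CommAlgCat.Hom.hom (rB.homEquiv.injective e)
  obtain ⟨P, ⟨⟨hP1, hP2⟩, hP3⟩, hP'⟩ := NewtonPoint.existsUnique_lift φ hφ hker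
    (rA.homEquiv (CommAlgCat.ofHom a) : NewtonPoint f N s R) c
    (rB.homEquiv (CommAlgCat.ofHom b) : NewtonPoint f N (s + 1) S)
    (by rw [htr, hb, hmapA]) (by rw [hdig]; exact funext hc)
  obtain ⟨g, rfl⟩ : ∃ g : B →ₐ[k] R, rB.homEquiv (CommAlgCat.ofHom g) = P := by
    obtain ⟨g, hg⟩ := (rB.homEquiv (Y := CommAlgCat.of k R)).surjective P
    exact ⟨g.hom, hg⟩
  refine ⟨g, ⟨⟨hinjA _ _ ?_, fun i => ?_⟩, hinjB _ _ ?_⟩, fun g' hg' => hinjB _ _ ?_⟩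
  · rw [← htr, hP1]
  · rw [hdig] at hP2
    exact congrFun hP2 i
  · rw [hmapB, hP3]
  · refine hP' _ ⟨⟨?_, ?_⟩, ?_⟩
    · rw [htr, hg'.1.1]
    · rw [hdig]
      exact funext hg'.1.2
    · rw [← hmapB, hg'.2]

theorem smoothOfRelativeDimension_corepHom {A B : Type u} [CommRing A]
    [Algebra k A] [Algebra.FiniteType k A] [CommRing B] [Algebra k B] [Algebra.FiniteType k B]
    (rA : (newtonFunctor f N s).CorepresentableBy (CommAlgCat.of k A))
    (rB : (newtonFunctor f N (s + 1)).CorepresentableBy (CommAlgCat.of k B)) :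
    SmoothOfRelativeDimension (n * N) (Spec.map (CommRingCat.ofHom
      (corepHom rB rA (newtonTrunc f N s)).hom.toRingHom)) := by
  let φ : A →ₐ[k] B := (corepHom rB rA (newtonTrunc f N s)).hom
  let : Algebra A B := φ.toRingHom.toAlgebra
  have : IsScalarTower k A B := .of_algebraMap_eq fun x => (φ.commutes x).symm
  obtain ⟨_, _, _⟩ := exists_etale_of_corepresentableBy rA rB (AlgHom.ext fun x => rfl)
  have hcard : Nat.card (Fin n × Fin N) = n * N := by simp
  have h1 := smoothOfRelativeDimension_of_etale_mvPolynomial (A := A) (B := B)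
    (ι := Fin n × Fin N)
  rw [hcard] at h1
  exact h1

theorem topologicalKrullDim_fiber_corepHom {A B : Type u} [CommRing A]
    [Algebra k A] [Algebra.FiniteType k A] [CommRing B] [Algebra k B] [Algebra.FiniteType k B]
    (rA : (newtonFunctor f N s).CorepresentableBy (CommAlgCat.of k A))
    (rB : (newtonFunctor f N (s + 1)).CorepresentableBy (CommAlgCat.of k B))
    (z : PrimeSpectrum A)
    (hz : Nonempty ((Spec.map (CommRingCat.ofHom
      (corepHom rB rA (newtonTrunc f N s)).hom.toRingHom)).fiber z)) :
    topologicalKrullDim ((Spec.map (CommRingCat.ofHom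
      (corepHom rB rA (newtonTrunc f N s)).hom.toRingHom)).fiber z) = (n * N : ℕ) := by
  let φ : A →ₐ[k] B := (corepHom rB rA (newtonTrunc f N s)).hom
  let : Algebra A B := φ.toRingHom.toAlgebra
  have : IsScalarTower k A B := .of_algebraMap_eq fun x => (φ.commutes x).symm
  obtain ⟨_, _, _⟩ := exists_etale_of_corepresentableBy rA rB (AlgHom.ext fun x => rfl)
  have hcard : Nat.card (Fin n × Fin N) = n * N := by simp
  have h2 := topologicalKrullDim_fiber_of_etale_mvPolynomial (A := A) (B := B)
    (ι := Fin n × Fin N) z (h := hz)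
  rw [hcard] at h2
  exact h2

end Truncations

end NewtonArc

/-! ### Assembly -/

theorem mainTheorem2 {k : Type u} [Field k] {n l : ℕ}
    (f : Fin l → MvPolynomial (Fin n ⊕ Fin l) k) (N : ℕ) :
    -- the functor of pairs is represented by a `k`-scheme `Z`
    ∃ (Z : Over (Spec (CommRingCat.of k)))
      (ρ : (NewtonArc.pointFunctor k).obj Z ≅ NewtonArc.arcFunctor f N),
      -- `Z` is the product of a `k`-scheme `Y` of finite type and an affine space
      (∃ (Y : Over (Spec (CommRingCat.of k))) (p₁ : Z ⟶ Y)
        (p₂ : Z ⟶ NewtonArc.affineSpace k (Fin n × Fin N × ℕ)),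
        LocallyOfFiniteType Y.hom ∧ QuasiCompact Y.hom ∧
        Nonempty (IsLimit (BinaryFan.mk p₁ p₂))) ∧
      -- the schemes `Z_r`, with `r = s + 2`, and the truncation morphisms between them
      ∃ (Zr : ℕ → Over (Spec (CommRingCat.of k)))
        (ρr : ∀ s, (NewtonArc.pointFunctor k).obj (Zr s) ≅ NewtonArc.newtonFunctor f N s)
        (τ : ∀ s, Zr (s + 1) ⟶ Zr s) (π : ∀ s, Z ⟶ Zr s)
        (hπ : ∀ s, π (s + 1) ≫ τ s = π s),
        (∀ s, (NewtonArc.pointFunctor k).map (τ s) ≫ (ρr s).hom =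
          (ρr (s + 1)).hom ≫ NewtonArc.newtonTrunc f N s) ∧
        (∀ s, (NewtonArc.pointFunctor k).map (π s) ≫ (ρr s).hom =
          ρ.hom ≫ NewtonArc.arcTrunc f N s) ∧
        (∀ s, IsAffine (Zr s).left ∧ LocallyOfFiniteType (Zr s).hom) ∧
        Nonempty (IsLimit (NewtonArc.towerCone τ π hπ)) ∧
        -- `Z_(r+1) ⟶ Z_r` is smooth, with nonempty fibers of dimension `n N`
        (∀ s, SmoothOfRelativeDimension (n * N) (τ s).left ∧
          ∀ z : (Zr s).left, Nonempty ((τ s).left.fiber z) →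
            topologicalKrullDim ((τ s).left.fiber z) = (n * N : ℕ)) ∧
        -- for `r ≥ 3`, over `Z_r`, the scheme `Z_(r+1)` is the product of `Z_r` and `𝔸^(n N)`
        ∀ s, 3 ≤ s + 2 → ∃ p : Zr (s + 1) ⟶ NewtonArc.affineSpace k (Fin n × Fin N),
          Nonempty (IsLimit (BinaryFan.mk (τ s) p)) := by
  choose A _ _ hA r using NewtonArc.exists_corepresentableBy_newtonFunctor f N
  replace r := fun s => (r s).some
  -- Z is built as Z_3 × 𝔸^I: index 1 stands for r = 3, the first level from which every lift is
  -- determined by its digits. Z_3 is also the factor of finite type.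
  obtain ⟨r'⟩ := NewtonArc.nonempty_corepresentableBy_mvPolynomial (r 1)
    (NewtonArc.arcTrunc f N 1) (I := Fin n × Fin N × ℕ)
    (fun R (p : NewtonArc.ArcPoint f N R) => p.digits)
    (fun φ (p : NewtonArc.ArcPoint f N _) => p.digits_map φ.hom)
    (fun _ p c => NewtonArc.ArcPoint.existsUnique_of_digits p c)
  let L := NewtonArc.specFunctor k
  have hft : ∀ s, LocallyOfFiniteType (L.obj (.op (CommAlgCat.of k (A s)))).hom := fun s => by
    refine (HasRingHomProperty.Spec_iff (P := @LocallyOfFiniteType)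
      (φ := CommRingCat.ofHom (algebraMap k (A s)))).2 ?_
    exact (RingHom.finiteType_algebraMap (A := k) (B := A s)).2 (hA s)
  have haff : ∀ s, IsAffine (L.obj (.op (CommAlgCat.of k (A s)))).left := fun s =>
    inferInstanceAs (IsAffine (Spec (CommRingCat.of (A s))))
  refine ⟨L.obj (.op (CommAlgCat.of k (MvPolynomial (Fin n × Fin N × ℕ) (A 1)))),
    NewtonArc.pointFunctorIso r', ?_, fun s => L.obj (.op (CommAlgCat.of k (A s))),
    fun s => NewtonArc.pointFunctorIso (r s),
    fun s => L.map (NewtonArc.corepHom (r (s + 1)) (r s) (NewtonArc.newtonTrunc f N s)).op,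
    fun s => L.map (NewtonArc.corepHom r' (r s) (NewtonArc.arcTrunc f N s)).op, ?_,
    fun s => NewtonArc.map_corepHom_comp_pointFunctorIso _ _ _,
    fun s => NewtonArc.map_corepHom_comp_pointFunctorIso _ _ _,
    fun s => ⟨haff s, hft s⟩, ?_, fun s =>
      have := hA s
      have := hA (s + 1)
      ⟨NewtonArc.smoothOfRelativeDimension_corepHom (r s) (r (s + 1)), fun z hz =>
        NewtonArc.topologicalKrullDim_fiber_corepHom (r s) (r (s + 1)) z hz⟩,
    fun s hs => ?_⟩
  · obtain ⟨p, hp⟩ := NewtonArc.exists_isLimit_binaryFan r' (r 1)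
      (NewtonArc.arcTrunc f N 1) (I := Fin n × Fin N × ℕ)
      (fun R (p : NewtonArc.ArcPoint f N R) => p.digits)
      (fun φ (p : NewtonArc.ArcPoint f N _) => p.digits_map φ.hom)
      (fun _ p c => NewtonArc.ArcPoint.existsUnique_of_digits p c)
    have : QuasiCompact (L.obj (.op (CommAlgCat.of k (A 1)))).hom :=
      inferInstanceAs (QuasiCompact (Spec.map (CommRingCat.ofHom (algebraMap k (A 1)))))
    exact ⟨_, _, p, hft 1, this, hp⟩
  · intro s
    rw [← L.map_comp, ← op_comp]
    refine congrArg (fun g => L.map (Quiver.Hom.op g)) ((r s).homEquiv.injective ?_)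
    have h := NewtonArc.homEquiv_corepHom_comp r' (r s) (NewtonArc.arcTrunc f N s) (𝟙 _)
    have h' := NewtonArc.homEquiv_corepHom_comp r' (r (s + 1))
      (NewtonArc.arcTrunc f N (s + 1)) (𝟙 _)
    rw [Category.comp_id] at h h'
    rw [NewtonArc.homEquiv_corepHom_comp, h, h']
    exact NewtonArc.ArcPoint.trunc_trunc _ _
  · exact NewtonArc.nonempty_isLimit_towerCone_algSpec r' r (NewtonArc.newtonTrunc f N)
      (NewtonArc.arcTrunc f N) (fun R p hp => NewtonArc.ArcPoint.existsUnique_of_compatible hp) _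
  -- The assumption r ≥ 3 means s ≥ 1, as needed for lifting over arbitrary R.
  · obtain ⟨s, rfl⟩ : ∃ t, s = t + 1 := ⟨s - 1, by omega⟩
    exact NewtonArc.exists_isLimit_binaryFan (r (s + 1 + 1)) (r (s + 1))
      (NewtonArc.newtonTrunc f N (s + 1))
      (fun R (p : NewtonArc.NewtonPoint f N (s + 2) R) => p.digits)
      (fun φ (p : NewtonArc.NewtonPoint f N _ _) => p.digits_map φ.hom)
      (fun _ p c => NewtonArc.NewtonPoint.existsUnique_of_trunc_digits p c)
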